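/- Let $Q(a)=a_1^2+a_2^2+a_3^2$ for $a\in\mathbb C^3$, and let $$\mathcal E_{\mathbb C}=\{[M]\in\mathbb P(\mathbb C^{3\times 3}) \;:\; \det M=0,\ 2(MM^T)M-\operatorname{tr}(MM^T)\,M=0\}$$ be the complex essential variety. For a projective variety $X\subseteq\mathbb P(\mathbb C^{3\times3})$, let $\operatorname{Sing}(X)$ be the set of points of $X$ at which the dimension of the Zariski tangent space (defined by the full homogeneous vanishing ideal of $X$) is larger than the local dimension of $X$, and let the second secant variety of $X$ be the Zariski closure of the union of all lines joining two distinct points of $X$. (i) The singular locus of $\mathcal E_{\mathbb C}$ is $$\operatorname{Sing}(\mathcal E_{\mathbb C})=\{[a\,b^T]\in\mathbb P(\mathbb C^{3\times3}) \;:\; a,b\in\mathbb C^3\setminus\{0\},\ Q(a)=Q(b)=0\},$$ and this set is a projective surface, i.e. an irreducible Zariski closed subset of dimension $2$. (ii) The second secant variety of $\operatorname{Sing}(\mathcal E_{\mathbb C})$ equals $\mathcal E_{\mathbb C}$. -/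

import Mathlib

open scoped LinearAlgebra.Projectivization Matrix

namespace EssentialVariety

/-- The projective space `ℙ(ℂ^{3×3})` of complex `3 × 3` matrices up to scale. -/
abbrev PMat : Type := ℙ ℂ (Matrix (Fin 3) (Fin 3) ℂ)

/-- The homogeneous coordinate ring `ℂ[m₁₁, …, m₃₃]` of `ℙ(ℂ^{3×3})`. -/
abbrev Poly : Type := MvPolynomial (Fin 3 × Fin 3) ℂ

/-- The value `f(M)` of a polynomial in the entries at a matrix `M`. -/
noncomputable def evalAt (M : Matrix (Fin 3) (Fin 3) ℂ) (f : Poly) : ℂ :=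
  MvPolynomial.eval (fun ij : Fin 3 × Fin 3 => M ij.1 ij.2) f

/-- `X ⊆ ℙ(ℂ^{3×3})` is Zariski closed: it is the set of common zeros of a set of
homogeneous polynomials. -/
def IsZariskiClosed (X : Set PMat) : Prop :=
  ∃ F : Set Poly, (∀ f ∈ F, ∃ d : ℕ, f.IsHomogeneous d) ∧
    X = {p | ∀ f ∈ F, evalAt p.rep f = 0}

/-- The Zariski closure: the intersection of all Zariski closed sets containing `X`. -/
def zariskiClosure (X : Set PMat) : Set PMat :=
  ⋂₀ {Y | IsZariskiClosed Y ∧ X ⊆ Y}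

/-- Irreducibility of a subset of `ℙ(ℂ^{3×3})` in the Zariski topology. -/
def IsZariskiIrreducible (X : Set PMat) : Prop :=
  X.Nonempty ∧ ∀ Y Z : Set PMat, IsZariskiClosed Y → IsZariskiClosed Z →
    X ⊆ Y ∪ Z → X ⊆ Y ∨ X ⊆ Z

/-- The vanishing ideal `I(X)`: the polynomials that vanish at every nonzero matrix representing
a point of `X`. (As `ℂ` is infinite this ideal is homogeneous, and it is generated by the
homogeneous polynomials vanishing on `X`.) -/
noncomputable def vanishingIdeal (X : Set PMat) : Ideal Poly where
  carrier := {f | ∀ (M : Matrix (Fin 3) (Fin 3) ℂ) (hM : M ≠ 0),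
    Projectivization.mk ℂ M hM ∈ X → evalAt M f = 0}
  add_mem' := by
    intro f g hf hg M hM hX
    have h1 := hf M hM hX
    have h2 := hg M hM hX
    simp only [evalAt] at h1 h2 ⊢
    rw [map_add, h1, h2, add_zero]
  zero_mem' := by
    intro M hM hX
    simp [evalAt]
  smul_mem' := by
    intro c f hf M hM hX
    have h1 := hf M hM hX
    simp only [evalAt] at h1 ⊢
    rw [smul_eq_mul, map_mul, h1, mul_zero]

/-- `X` has (projective) dimension `d`: its homogeneous coordinate ring `ℂ[m]/I(X)` has Krull
dimension `d + 1`. -/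
def HasDimension (X : Set PMat) (d : ℕ) : Prop :=
  ringKrullDim (Poly ⧸ vanishingIdeal X) = ((d + 1 : ℕ) : WithBot ℕ∞)

/-- A projective surface: an irreducible Zariski closed set of dimension two. -/
def IsProjectiveSurface (X : Set PMat) : Prop :=
  IsZariskiClosed X ∧ IsZariskiIrreducible X ∧ HasDimension X 2

/-- The Zariski tangent space of the affine cone over `X` at (a representative of) the point `p`,
the kernel of the Jacobian of `I(X)`: all `V` with `∑ ∂f/∂mᵢⱼ(p) Vᵢⱼ = 0` for all `f ∈ I(X)`.
Its dimension is one more than that of the Zariski tangent space of `X` at `p`. -/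
noncomputable def coneTangentSpace (X : Set PMat) (p : PMat) :
    Submodule ℂ (Matrix (Fin 3) (Fin 3) ℂ) where
  carrier := {V | ∀ f ∈ vanishingIdeal X,
    ∑ ij : Fin 3 × Fin 3, evalAt p.rep (MvPolynomial.pderiv ij f) * V ij.1 ij.2 = 0}
  add_mem' := by
    intro V W hV hW f hf
    simp only [Matrix.add_apply, mul_add, Finset.sum_add_distrib]
    rw [hV f hf, hW f hf, add_zero]
  zero_mem' := by
    intro f hf
    simp
  smul_mem' := by
    intro c V hV f hf
    simp only [Matrix.smul_apply, smul_eq_mul, mul_left_comm _ c, ← Finset.mul_sum]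
    rw [hV f hf, mul_zero]

/-- The local dimension at `p` of the affine cone over `X`: the largest dimension of an irreducible
component of the cone (a minimal prime of `I(X)`) that passes through `p`. It is one more than
the local dimension of `X` at `p`. -/
noncomputable def coneLocalDim (X : Set PMat) (p : PMat) : WithBot ℕ∞ :=
  ⨆ q : {q : Ideal Poly // q ∈ (vanishingIdeal X).minimalPrimes ∧ ∀ f ∈ q, evalAt p.rep f = 0},
    ringKrullDim (Poly ⧸ q.1)

/-- The singular locus of `X`: the points of `X` at which the dimension of the Zariski tangent
space exceeds the local dimension (both taken on the affine cone, which shifts both by one). -/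
def singularLocus (X : Set PMat) : Set PMat :=
  {p | p ∈ X ∧ coneLocalDim X p <
    ((Module.finrank ℂ (coneTangentSpace X p) : ℕ) : WithBot ℕ∞)}

/-- The second secant variety: the Zariski closure of the union of all lines joining two distinct
points of `X`. -/
def secondSecantVariety (X : Set PMat) : Set PMat :=
  zariskiClosure {p | ∃ x ∈ X, ∃ y ∈ X, x ≠ y ∧ p.submodule ≤ x.submodule ⊔ y.submodule}

/-- The complex essential variety: the points `[M]` with
`det M = 0` and `2 (M Mᵀ) M - tr(M Mᵀ) M = 0` (homogeneous equations). -/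
def essentialVariety : Set PMat :=
  {p | p.rep.det = 0 ∧
    (2 : ℂ) • ((p.rep * p.repᵀ) * p.rep) - (p.rep * p.repᵀ).trace • p.rep = 0}

/-- The quadratic form `Q(a) = a₁² + a₂² + a₃²` on `ℂ³`. -/
def Q (a : Fin 3 → ℂ) : ℂ := a 0 ^ 2 + a 1 ^ 2 + a 2 ^ 2

/-- The points `[a bᵀ]` with `Q(a) = Q(b) = 0` (`a`, `b` nonzero, so that `a bᵀ ≠ 0`). -/
def isotropicProducts : Set PMat :=
  {p | ∃ (a b : Fin 3 → ℂ) (h : Matrix.vecMulVec a b ≠ 0),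
    Q a = 0 ∧ Q b = 0 ∧ p = Projectivization.mk ℂ (Matrix.vecMulVec a b) h}

end EssentialVariety

/-! The map `spinor` identifies `3 × 3` matrices with the symmetric `4 × 4` matrices `W` satisfying
`W 0 3 = W 1 2`, that is, with the summand `Sym² ⊗ Sym²` of `Sym² (ℂ² ⊗ ℂ²)`. Let `q(n) = n₀n₃ -
n₁n₂`. An isotropic product becomes a multiple of a square `n nᵀ` with `q(n) = 0`, and the equations
of the essential variety become the `3 × 3` minors of `W` (`spinor_minors`). A point of the
essential cone is therefore `u vᵀ + v uᵀ`, and the linear condition on `W` says that `u` and `v` are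
orthogonal for the polar form of `q`.

Secants: if `q(u) + q(v) = 0`, then `u ± v` lie on the quadric and `u vᵀ + v uᵀ` is half the
difference of their squares. Rescaling `u` and `v` inversely reaches this case unless exactly one of
`q(u)`, `q(v)` vanishes, and a perturbation covers the rest (`evalAt_eq_zero_of_mem_essentialCone`).
Sums of two isotropic products are thus dense in the essential cone.

Dimension: the two vanishing ideals are kernels of polynomial parametrizations, hence prime, and
comparing transcendence degrees gives cones of dimension 3 and 6.

Singularities: at an isotropic product the cone contains every line in an isotropic direction, and
these directions span all of `ℂ⁹` (`coneTangentSpace_eq_top`). Elsewhere `W` has rank 2, and a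
tangent vector must vanish as a quadratic form on the 2-dimensional kernel of `W`. These are three
independent conditions, so the tangent space has dimension at most 6
(`finrank_coneTangentSpace_le`). -/

namespace EssentialVariety

open Matrix

/-! ### Krull dimension of a parametrized variety -/

section KrullDimension

open Algebra

/-- Incomparability bounds the dimension of `S` from above; lying over and going up lift chains from
`R`. -/
theorem ringKrullDim_eq_of_injective_of_isIntegral {R S : Type*} [CommRing R] [CommRing S]
    [Algebra R S] [Algebra.IsIntegral R S]
    (hinj : Function.Injective (algebraMap R S)) : ringKrullDim S = ringKrullDim R := by
  apply le_antisymm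
  · refine Order.krullDim_le_of_strictMono (PrimeSpectrum.comap (algebraMap R S)) ?_
    intro P Q hPQ
    exact Ideal.IsIntegral.comap_lt_comap (I := P.asIdeal) (J := Q.asIdeal) hPQ
  · refine iSup_le fun l => ?_
    have : FaithfulSMul R S := (faithfulSMul_iff_algebraMap_injective R S).2 hinj
    obtain ⟨⟨P, hP⟩⟩ := Ideal.nonempty_primesOver (S := S) l.head.asIdeal
    have := hP.1
    have := hP.2
    obtain ⟨m, hm, -⟩ := Ideal.exists_ltSeries_of_hasGoingUp l P
    rw [← hm]
    exact Order.LTSeries.length_le_krullDim m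

/-- The quotient embeds into a polynomial ring in `n` variables through `ψ` and contains one through
`g`, so its transcendence degree is `n`. Noether normalization turns this into Krull dimension. -/
theorem ringKrullDim_quotient_ker_of_comp_injective {σ : Type} [Finite σ] {n : ℕ}
    (ψ : MvPolynomial σ ℂ →ₐ[ℂ] MvPolynomial (Fin n) ℂ)
    (g : MvPolynomial (Fin n) ℂ →ₐ[ℂ] MvPolynomial σ ℂ)
    (h : Function.Injective (ψ.comp g)) :
    ringKrullDim (MvPolynomial σ ℂ ⧸ RingHom.ker ψ) = n := by
  have hp : (RingHom.ker ψ).IsPrime := RingHom.ker_isPrime _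
  have hdom : IsDomain (MvPolynomial σ ℂ ⧸ RingHom.ker ψ) := Ideal.Quotient.isDomain _
  have h1 : Algebra.trdeg ℂ (MvPolynomial σ ℂ ⧸ RingHom.ker ψ) ≤ n := by
    have := trdeg_le_of_injective _ (Ideal.kerLiftAlg_injective ψ)
    simpa using this
  have h2 : (n : Cardinal) ≤ Algebra.trdeg ℂ (MvPolynomial σ ℂ ⧸ RingHom.ker ψ) := by
    have hi : Function.Injective ((Ideal.Quotient.mkₐ ℂ (RingHom.ker ψ)).comp g) := by
      intro x y hxy
      apply h
      have := congrArg (Ideal.kerLiftAlg ψ) hxy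
      simpa using this
    have := trdeg_le_of_injective _ hi
    simpa using this
  obtain ⟨s, k, hk, hint⟩ := exists_integral_inj_algHom_of_fg ℂ (MvPolynomial σ ℂ ⧸ RingHom.ker ψ)
  algebraize [k.toRingHom]
  have : Algebra.IsIntegral (MvPolynomial (Fin s) ℂ) (MvPolynomial σ ℂ ⧸ RingHom.ker ψ) := ⟨hint⟩
  have hinj : Function.Injective
    (algebraMap (MvPolynomial (Fin s) ℂ) (MvPolynomial σ ℂ ⧸ RingHom.ker ψ)) := hk
  have : FaithfulSMul (MvPolynomial (Fin s) ℂ) (MvPolynomial σ ℂ ⧸ RingHom.ker ψ) :=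
    (faithfulSMul_iff_algebraMap_injective _ _).2 hinj
  have h3 := trdeg_add_eq ℂ (MvPolynomial (Fin s) ℂ)
    (A := MvPolynomial σ ℂ ⧸ RingHom.ker ψ)
  rw [trdeg_eq_zero (R := MvPolynomial (Fin s) ℂ), add_zero] at h3
  simp only [MvPolynomial.trdeg_of_isDomain, Cardinal.mk_fintype, Fintype.card_fin,
    Cardinal.lift_natCast] at h3
  have h4 : s = n := by
    rw [← h3] at h1 h2
    exact le_antisymm (by exact_mod_cast h1) (by exact_mod_cast h2)
  rw [ringKrullDim_eq_of_injective_of_isIntegral hinj,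
    MvPolynomial.ringKrullDim_of_isNoetherianRing, h4]
  simp

end KrullDimension

/-! ### Affine cones and sums of isotropic products -/

/-- The affine cone over the essential variety. -/
def essentialCone : Set (Matrix (Fin 3) (Fin 3) ℂ) :=
  {M | M.det = 0 ∧ (2 : ℂ) • ((M * Mᵀ) * M) - (M * Mᵀ).trace • M = 0}

/-- The affine cone over the products of isotropic vectors. -/
def isotropicCone : Set (Matrix (Fin 3) (Fin 3) ℂ) :=
  {M | ∃ a b : Fin 3 → ℂ, Q a = 0 ∧ Q b = 0 ∧ M = vecMulVec a b}

theorem Q_eq_dotProduct (a : Fin 3 → ℂ) : Q a = a ⬝ᵥ a := by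
  simp [Q, dotProduct, Fin.sum_univ_three, pow_two]

theorem smul_mem_isotropicCone {M : Matrix (Fin 3) (Fin 3) ℂ} (hM : M ∈ isotropicCone) (c : ℂ) :
    c • M ∈ isotropicCone := by
  obtain ⟨a, b, ha, hb, rfl⟩ := hM
  refine ⟨c • a, b, ?_, hb, by rw [smul_vecMulVec]⟩
  rw [Q_eq_dotProduct] at ha ⊢
  simp [ha]

theorem smul_mem_essentialCone {M : Matrix (Fin 3) (Fin 3) ℂ} (hM : M ∈ essentialCone) (c : ℂ) :
    c • M ∈ essentialCone := by
  obtain ⟨h1, h2⟩ := hM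
  refine ⟨by simp [h1], ?_⟩
  have : (2 : ℂ) • (((c • M) * (c • M)ᵀ) * (c • M)) - ((c • M) * (c • M)ᵀ).trace • (c • M)
      = c ^ 3 • ((2 : ℂ) • ((M * Mᵀ) * M) - (M * Mᵀ).trace • M) := by
    simp only [transpose_smul, smul_mul_assoc, mul_smul_comm, trace_smul, smul_eq_mul, smul_sub,
      smul_smul]
    congr 2 <;> ring
  rw [this, h2, smul_zero]

/-- For `M = abᵀ + cdᵀ` the rank is at most 2, and isotropy leaves `MMᵀ = (b·d)(acᵀ + caᵀ)`. Hence
`MMᵀM = (a·c)(b·d)M`, while the trace of `MMᵀ` is `2(a·c)(b·d)`. -/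
theorem add_mem_essentialCone {M N : Matrix (Fin 3) (Fin 3) ℂ} (hM : M ∈ isotropicCone)
    (hN : N ∈ isotropicCone) : M + N ∈ essentialCone := by
  obtain ⟨a, b, ha, hb, rfl⟩ := hM
  obtain ⟨c, d, hc, hd, rfl⟩ := hN
  rw [Q_eq_dotProduct] at ha hb hc hd
  constructor
  · simp only [det_fin_three, Matrix.add_apply, vecMulVec_apply]
    ring
  · have h : (vecMulVec a b + vecMulVec c d) * (vecMulVec a b + vecMulVec c d)ᵀ =
        (b ⬝ᵥ d) • (vecMulVec a c + vecMulVec c a) := by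
      simp only [transpose_add, transpose_vecMulVec, mul_add, add_mul, vecMulVec_mul_vecMulVec,
        hb, hd, dotProduct_comm d b]
      ext i k
      simp [vecMulVec_apply]
      ring
    rw [h]
    simp only [smul_mul_assoc, mul_add, add_mul, vecMulVec_mul_vecMulVec, ha, hc,
      dotProduct_comm c a, trace_smul, trace_add, trace_vecMulVec]
    ext i k
    simp [vecMulVec_apply]
    ring

/-! ### Isotropic vectors and the symmetric `4 × 4` model -/

/-- The quadratic parametrization of the isotropic vectors of `ℂ³` (for `j² = -1`). -/
def isoVec {R : Type*} [CommRing R] (j a b : R) : Fin 3 → R :=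
  ![a ^ 2 - b ^ 2, j * (a ^ 2 + b ^ 2), 2 * (a * b)]

theorem Q_isoVec (a b : ℂ) : Q (isoVec Complex.I a b) = 0 := by
  simp only [Q, isoVec, cons_val]
  linear_combination (a ^ 2 + b ^ 2) ^ 2 * Complex.I_sq

/-- Isotropy reads `(a₀ - i a₁)(a₀ + i a₁) = -a₂²`, so the parameters are square roots of the two
factors up to constants, with signs matched through `a₂`. -/
theorem exists_eq_isoVec {a : Fin 3 → ℂ} (ha : Q a = 0) :
    ∃ s t : ℂ, a = isoVec Complex.I s t := by
  have key : ∀ s t : ℂ, a 0 - Complex.I * a 1 = 2 * s ^ 2 → a 0 + Complex.I * a 1 = -(2 * t ^ 2) →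
      a 2 = 2 * (s * t) → a = isoVec Complex.I s t := by
    intro s t h1 h2 h3
    ext i
    fin_cases i
    · simp [isoVec]
      linear_combination (h1 + h2) / 2
    · simp [isoVec]
      linear_combination Complex.I / 2 * (h1 - h2) + a 1 * Complex.I_sq
    · simpa [isoVec] using h3
  have hQ : (a 0 - Complex.I * a 1) * (a 0 + Complex.I * a 1) = -(a 2) ^ 2 := by
    simp only [Q] at ha
    linear_combination ha - a 1 ^ 2 * Complex.I_sq
  obtain ⟨s, hs⟩ := IsAlgClosed.exists_pow_nat_eq ((a 0 - Complex.I * a 1) / 2) zero_lt_two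
  by_cases h0 : s = 0
  · obtain ⟨t, ht⟩ := IsAlgClosed.exists_pow_nat_eq (-(a 0 + Complex.I * a 1) / 2) zero_lt_two
    have h1 : a 0 - Complex.I * a 1 = 0 := by
      rw [h0] at hs
      linear_combination -2 * hs
    have h2 : a 2 = 0 := by
      rw [h1] at hQ
      have : a 2 ^ 2 = 0 := by linear_combination hQ
      exact pow_eq_zero_iff (two_ne_zero) |>.1 this
    exact ⟨s, t, key s t (by linear_combination -2 * hs) (by linear_combination 2 * ht)
      (by simp [h0, h2])⟩
  · refine ⟨s, a 2 / (2 * s), key _ _ (by linear_combination -2 * hs) ?_ (by field_simp)⟩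
    have : a 0 - Complex.I * a 1 = 2 * s ^ 2 := by linear_combination -2 * hs
    rw [this] at hQ
    field_simp
    linear_combination hQ

/-- The symmetric `4 × 4` matrix of the quadratic form on `ℂ² ⊗ ℂ²` attached to a `3 × 3` matrix by
`Sym² ℂ² ⊗ Sym² ℂ² ⊆ Sym² (ℂ² ⊗ ℂ²)` (for `j² = -1`). -/
def spinor {R : Type*} [CommRing R] (j : R) (M : Matrix (Fin 3) (Fin 3) R) :
    Matrix (Fin 4) (Fin 4) R :=
  let m00 := M 0 0 - M 1 1 - j * (M 0 1 + M 1 0)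
  let m01 := M 0 2 - j * M 1 2
  let m02 := -(M 0 0 + M 1 1 + j * (M 0 1 - M 1 0))
  let m10 := M 2 0 - j * M 2 1
  let m11 := M 2 2
  let m12 := -(M 2 0 + j * M 2 1)
  let m20 := -(M 0 0 + M 1 1 - j * (M 0 1 - M 1 0))
  let m21 := -(M 0 2 + j * M 1 2)
  let m22 := M 0 0 - M 1 1 + j * (M 0 1 + M 1 0)
  !![m00, m01, m10, m11; m01, m02, m11, m12; m10, m11, m20, m21; m11, m12, m21, m22]

/-- The inverse of `spinor` on symmetric matrices `W` with `W₀₃ = W₁₂`. -/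
noncomputable def ofSpinor (W : Matrix (Fin 4) (Fin 4) ℂ) : Matrix (Fin 3) (Fin 3) ℂ :=
  !![(W 0 0 + W 3 3 - W 1 1 - W 2 2) / 4,
      Complex.I * (W 0 0 - W 3 3 + W 1 1 - W 2 2) / 4, (W 0 1 - W 2 3) / 2;
    Complex.I * (W 0 0 - W 3 3 - W 1 1 + W 2 2) / 4,
      -(W 0 0 + W 3 3 + W 1 1 + W 2 2) / 4, Complex.I * (W 0 1 + W 2 3) / 2;
    (W 0 2 - W 1 3) / 2, Complex.I * (W 0 2 + W 1 3) / 2, W 0 3]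

theorem spinor_isSymm {R : Type*} [CommRing R] (j : R) (M : Matrix (Fin 3) (Fin 3) R) (i k : Fin 4) :
    spinor j M i k = spinor j M k i := by
  fin_cases i <;> fin_cases k <;> simp [spinor]

theorem spinor_apply_zero_three {R : Type*} [CommRing R] (j : R) (M : Matrix (Fin 3) (Fin 3) R) :
    spinor j M 0 3 = spinor j M 1 2 := by
  simp [spinor]

theorem spinor_add {R : Type*} [CommRing R] (j : R) (M N : Matrix (Fin 3) (Fin 3) R) :
    spinor j (M + N) = spinor j M + spinor j N := by
  ext i k
  fin_cases i <;> fin_cases k <;> simp [spinor] <;> ring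

theorem spinor_smul {R : Type*} [CommRing R] (j c : R) (M : Matrix (Fin 3) (Fin 3) R) :
    spinor j (c • M) = c • spinor j M := by
  ext i k
  fin_cases i <;> fin_cases k <;> simp [spinor] <;> ring

theorem spinor_map {R S : Type*} [CommRing R] [CommRing S] (φ : R →+* S) (j : R)
    (M : Matrix (Fin 3) (Fin 3) R) : (spinor j M).map φ = spinor (φ j) (M.map φ) := by
  ext i k
  fin_cases i <;> fin_cases k <;> simp [spinor]

theorem ofSpinor_spinor (M : Matrix (Fin 3) (Fin 3) ℂ) : ofSpinor (spinor Complex.I M) = M := by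
  have hI := Complex.I_sq
  ext i k
  fin_cases i <;> fin_cases k <;> simp [spinor, ofSpinor] <;> ring_nf <;> simp only [hI] <;> ring

theorem spinor_ofSpinor {W : Matrix (Fin 4) (Fin 4) ℂ} (hW : ∀ i k, W i k = W k i)
    (h03 : W 0 3 = W 1 2) : spinor Complex.I (ofSpinor W) = W := by
  have hI := Complex.I_sq
  ext i k
  fin_cases i <;> fin_cases k <;>
    simp [spinor, ofSpinor, hW 1 0, hW 2 0, hW 2 1, hW 3 0, hW 3 1, hW 3 2, ← h03] <;>
    ring_nf <;> simp only [hI] <;> ring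

theorem spinor_injective : Function.Injective (spinor Complex.I) :=
  Function.LeftInverse.injective ofSpinor_spinor

theorem spinor_vecMulVec_isoVec (a b c d : ℂ) :
    spinor Complex.I (vecMulVec (isoVec Complex.I a b) (isoVec Complex.I c d)) =
      (4 : ℂ) • vecMulVec ![a * c, a * d, b * c, b * d] ![a * c, a * d, b * c, b * d] := by
  have hI := Complex.I_sq
  ext i k
  fin_cases i <;> fin_cases k <;> simp [spinor, isoVec, vecMulVec_apply] <;> ring_nf <;>
    simp only [hI] <;> ring

/-- This is the factorization of a `2 × 2` matrix of determinant zero, i.e. the Segre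
parametrization of the quadric. -/
theorem exists_eq_tensor {n : Fin 4 → ℂ} (h : n 0 * n 3 = n 1 * n 2) :
    ∃ a b c d : ℂ, n = ![a * c, a * d, b * c, b * d] := by
  have key : ∀ a b c d : ℂ, n 0 = a * c → n 1 = a * d → n 2 = b * c → n 3 = b * d →
      n = ![a * c, a * d, b * c, b * d] := by
    intro a b c d h0 h1 h2 h3
    ext i
    fin_cases i <;> simp [*]
  by_cases h0 : n 0 = 0
  · have : n 1 = 0 ∨ n 2 = 0 := by
      rw [h0, zero_mul] at h
      exact mul_eq_zero.1 h.symm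
    rcases this with h1 | h2
    · exact ⟨0, 1, n 2, n 3, key _ _ _ _ (by simp [h0]) (by simp [h1]) (by simp) (by simp)⟩
    · exact ⟨n 1, n 3, 0, 1, key _ _ _ _ (by simp [h0]) (by simp) (by simp [h2]) (by simp)⟩
  · refine ⟨n 0, n 2, 1, n 1 / n 0, key _ _ _ _ (by simp) (by field_simp) (by simp) ?_⟩
    field_simp
    linear_combination h

theorem mem_isotropicCone_of_spinor_eq {M : Matrix (Fin 3) (Fin 3) ℂ} {n : Fin 4 → ℂ}
    (h : n 0 * n 3 = n 1 * n 2) {c : ℂ} (hM : spinor Complex.I M = c • vecMulVec n n) :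
    M ∈ isotropicCone := by
  obtain ⟨a, b, c', d, hn⟩ := exists_eq_tensor h
  have : M = (c / 4) • vecMulVec (isoVec Complex.I a b) (isoVec Complex.I c' d) := by
    apply spinor_injective
    rw [spinor_smul, spinor_vecMulVec_isoVec, hM, smul_smul, ← hn]
    congr 1
    ring
  rw [this]
  exact smul_mem_isotropicCone ⟨_, _, Q_isoVec _ _, Q_isoVec _ _, rfl⟩ _

/-- A map `Fin n → Fin (n + 1)` misses some value and so factors through a `succAbove`. This also
covers selections with repeated or permuted indices. -/
theorem det_submatrix_eq_zero {R : Type*} [CommRing R] {n : ℕ}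
    {S : Matrix (Fin (n + 1)) (Fin (n + 1)) R}
    (hS : ∀ i k : Fin (n + 1), (S.submatrix i.succAbove k.succAbove).det = 0)
    (r c : Fin n → Fin (n + 1)) : (S.submatrix r c).det = 0 := by
  have key : ∀ r : Fin n → Fin (n + 1), ∃ (i : Fin (n + 1)) (σ : Fin n → Fin n),
      r = i.succAbove ∘ σ := by
    intro r
    have : ¬ Function.Surjective r := fun h => by
      have := Fintype.card_le_of_surjective r h
      simp at this
    simp only [Function.Surjective, not_forall, not_exists] at this
    obtain ⟨i, hi⟩ := this
    choose σ hσ using fun x => Fin.exists_succAbove_eq (hi x)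
    exact ⟨i, σ, funext fun x => (hσ x).symm⟩
  obtain ⟨i, σ, rfl⟩ := key r
  obtain ⟨k, τ, rfl⟩ := key c
  have : S.submatrix (i.succAbove ∘ σ) (k.succAbove ∘ τ) =
      (1 : Matrix (Fin n) (Fin n) R).submatrix σ id * S.submatrix i.succAbove k.succAbove *
        (1 : Matrix (Fin n) (Fin n) R).submatrix id τ := by
    have h1 := one_submatrix_mul (l := Fin n) σ (Equiv.refl (Fin n))
      (S.submatrix i.succAbove k.succAbove)
    have h2 := mul_submatrix_one (Equiv.refl (Fin n)) τ
      ((S.submatrix i.succAbove k.succAbove).submatrix σ id)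
    simp only [Equiv.coe_refl, Equiv.refl_symm, Function.id_comp] at h1 h2
    rw [h1, h2]
    rfl
  rw [this, det_mul, det_mul, hS, mul_zero, zero_mul]

/-- Up to symmetry there are ten minors, matching the ten cubic equations; each minor is an explicit
linear combination of these cubics over `ℚ(i)`. -/
theorem spinor_minors {M : Matrix (Fin 3) (Fin 3) ℂ} (hM : M ∈ essentialCone) (i k : Fin 4) :
    ((spinor Complex.I M).submatrix i.succAbove k.succAbove).det = 0 := by
  obtain ⟨hd, hE⟩ := hM
  have hI := Complex.I_sq
  have hI3 := Complex.I_pow_three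
  rw [det_fin_three] at hd
  have hE' : ∀ a b, ((2 : ℂ) • ((M * Mᵀ) * M) - (M * Mᵀ).trace • M) a b = 0 := by
    intro a b
    rw [hE]
    rfl
  simp only [Matrix.sub_apply, Matrix.smul_apply, Matrix.mul_apply, Fin.sum_univ_three, trace,
    diag_apply, transpose_apply, smul_eq_mul] at hE'
  have h00 := hE' 0 0
  have h01 := hE' 0 1
  have h02 := hE' 0 2
  have h10 := hE' 1 0
  have h11 := hE' 1 1
  have h12 := hE' 1 2
  have h20 := hE' 2 0
  have h21 := hE' 2 1
  have h22 := hE' 2 2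
  clear hE hE'
  wlog hik : i ≤ k generalizing i k with H
  · rw [← det_transpose, transpose_submatrix]
    have : (spinor Complex.I M)ᵀ = spinor Complex.I M := by
      ext a b
      exact spinor_isSymm _ _ _ _
    rw [this]
    exact H k i (not_le.1 hik).le
  rw [det_fin_three]
  simp only [submatrix_apply]
  fin_cases i <;> fin_cases k <;> first
    | exact absurd hik (by decide)
    | simp only [Fin.succAbove, spinor]
      simp
  · linear_combination (norm := (ring_nf; simp only [hI, hI3]; ring)) h00 + Complex.I * h01 + Complex.I * h10 - h11
  · linear_combination (norm := (ring_nf; simp only [hI, hI3]; ring)) -h02 + (-Complex.I) * h12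
  · linear_combination (norm := (ring_nf; simp only [hI, hI3]; ring)) h20 + Complex.I * h21
  · linear_combination (norm := (ring_nf; simp only [hI]; ring)) 2 * hd - h22
  · linear_combination (norm := (ring_nf; simp only [hI, hI3]; ring)) -h00 + Complex.I * h01 + (-Complex.I) * h10 - h11
  · linear_combination (norm := (ring_nf; simp only [hI]; ring)) (-2) * hd - h22
  · linear_combination (norm := (ring_nf; simp only [hI, hI3]; ring)) -h20 + Complex.I * h21
  · linear_combination (norm := (ring_nf; simp only [hI, hI3]; ring)) -h00 + (-Complex.I) * h01 + Complex.I * h10 - h11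
  · linear_combination (norm := (ring_nf; simp only [hI, hI3]; ring)) h02 + (-Complex.I) * h12
  · linear_combination (norm := (ring_nf; simp only [hI, hI3]; ring)) h00 + (-Complex.I) * h01 + (-Complex.I) * h10 - h11

/-! ### Symmetric matrices of rank at most two -/

/-- A symmetric matrix all of whose `2 × 2` minors vanish is a square. -/
theorem exists_eq_vecMulVec_self {n : Type*} {S : Matrix n n ℂ} (hS : ∀ i k, S i k = S k i)
    (h : ∀ i j k l, S i k * S j l = S i l * S j k) : ∃ x : n → ℂ, S = vecMulVec x x := by
  by_cases h0 : ∃ i, S i i ≠ 0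
  · obtain ⟨i, hi⟩ := h0
    obtain ⟨s, hs⟩ := IsAlgClosed.exists_pow_nat_eq (S i i) zero_lt_two
    have hs0 : s ≠ 0 := by
      rintro rfl
      exact hi (by rw [← hs]; simp)
    refine ⟨fun k => S i k / s, ?_⟩
    ext k l
    rw [vecMulVec_apply]
    field_simp
    rw [hs]
    linear_combination (h i k i l) + (S i l) * hS k i
  · push Not at h0
    refine ⟨0, ?_⟩
    ext k l
    have : S k l ^ 2 = 0 := by
      have := h k l k l
      rw [h0, h0, hS l k] at this
      linear_combination -this
    simpa using this

/-- A symmetric matrix all of whose `3 × 3` minors vanish is a sum of two squares, and so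
a symmetric product of two vectors. -/
theorem exists_eq_vecMulVec_add_vecMulVec {n : Type*} {S : Matrix n n ℂ}
    (hS : ∀ i k, S i k = S k i) (h : ∀ r c : Fin 3 → n, (S.submatrix r c).det = 0) :
    ∃ u v : n → ℂ, S = vecMulVec u v + vecMulVec v u := by
  have h' : ∀ i j k l m o, (S.submatrix ![i, j, k] ![l, m, o]).det = 0 :=
    fun i j k l m o => h _ _
  simp only [det_fin_three, submatrix_apply, cons_val] at h'
  by_cases h0 : ∃ i, S i i ≠ 0
  · obtain ⟨i, hi⟩ := h0
    obtain ⟨s, hs⟩ := IsAlgClosed.exists_pow_nat_eq (S i i) zero_lt_two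
    have hs0 : s ≠ 0 := by
      rintro rfl
      exact hi (by rw [← hs]; simp)
    -- The Schur complement of the pivot `S i i` has vanishing `2 × 2` minors, so `S = xxᵀ + yyᵀ`,
    -- which factors through `x ± iy`.
    obtain ⟨y, hy⟩ := exists_eq_vecMulVec_self
      (S := of fun k l => S k l - S i k * S i l / S i i)
      (by
        intro k l
        simp only [of_apply]
        rw [hS k l]
        ring)
      (by
        intro j k l m
        simp only [of_apply]
        field_simp
        have := h' i j k i l m
        rw [hS j i, hS k i] at this
        have h3 : S i i * (S j l * S k m - S j m * S k l) - S i l * (S i j * S k m - S i k * S j m)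
          + S i m * (S i j * S k l - S i k * S j l) = 0 := by linear_combination this
        linear_combination S i i * h3)
    refine ⟨fun k => S i k / s + Complex.I * y k, fun k => (S i k / s - Complex.I * y k) / 2, ?_⟩
    ext k l
    have hy' := congrFun (congrFun hy k) l
    simp only [of_apply, vecMulVec_apply] at hy'
    simp only [Matrix.add_apply, vecMulVec_apply]
    rw [← hs] at hy'
    linear_combination hy' + (y k * y l) * Complex.I_sq
  · push Not at h0
    by_cases h1 : ∃ i j, S i j ≠ 0
    · obtain ⟨i, j, hij⟩ := h1
      -- With zero diagonal, the pivot is the hyperbolic block on the indices `i`, `j`.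
      refine ⟨S i, fun k => S j k / S i j, ?_⟩
      ext k l
      simp only [Matrix.add_apply, vecMulVec_apply]
      field_simp
      have := h' i j k i j l
      rw [h0 i, h0 j, hS j i, hS k i, hS k j] at this
      have h3 : S i j * (S i j * S k l - (S i k * S j l + S i l * S j k)) = 0 := by
        linear_combination -this
      have := (mul_eq_zero.1 h3).resolve_left hij
      linear_combination this
    · push Not at h1
      refine ⟨0, 0, ?_⟩
      ext k l
      simp [h1]

/-! ### Density of sums of two isotropic products -/

theorem continuous_evalAt (f : Poly) : Continuous fun M => evalAt M f := by
  unfold evalAt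
  exact (MvPolynomial.continuous_eval f).comp (by fun_prop)

theorem evalAt_eq_zero_of_finite_compl {f : Poly} {γ : ℂ → Matrix (Fin 3) (Fin 3) ℂ}
    (hγ : Continuous γ) {s : Set ℂ} (hs : s.Finite) (h : ∀ x ∉ s, evalAt (γ x) f = 0) (x : ℂ) :
    evalAt (γ x) f = 0 := by
  have hc : IsClosed {x | evalAt (γ x) f = 0} :=
    isClosed_eq ((continuous_evalAt f).comp hγ) continuous_const
  have hd : Dense sᶜ := hs.countable.dense_compl ℂ
  have := hc.closure_subset_iff.2 (show sᶜ ⊆ _ from h)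
  rw [hd.closure_eq] at this
  exact this (Set.mem_univ x)

theorem evalAt_zero_of_smul {f : Poly} {M : Matrix (Fin 3) (Fin 3) ℂ}
    (h : ∀ c : ℂ, c ≠ 0 → evalAt (c • M) f = 0) : evalAt 0 f = 0 := by
  have := evalAt_eq_zero_of_finite_compl (γ := fun c : ℂ => c • M) (by fun_prop)
    (Set.finite_singleton 0) (fun c hc => h c hc) 0
  simpa using this

/-- A parametrization of a dense subset of `isotropicCone` (for `j² = -1`). -/
def isoParam {R : Type*} [CommRing R] (j a b t : R) : Matrix (Fin 3) (Fin 3) R :=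
  vecMulVec (isoVec j a b) (isoVec j 1 t)

theorem isoParam_mem (a b t : ℂ) : isoParam Complex.I a b t ∈ isotropicCone :=
  ⟨_, _, Q_isoVec _ _, Q_isoVec _ _, rfl⟩

theorem evalAt_add_eq_zero_of_isoParam {f : Poly} {N : Matrix (Fin 3) (Fin 3) ℂ}
    (h : ∀ a b t, evalAt (N + isoParam Complex.I a b t) f = 0) {M : Matrix (Fin 3) (Fin 3) ℂ}
    (hM : M ∈ isotropicCone) : evalAt (N + M) f = 0 := by
  obtain ⟨a, b, ha, hb, rfl⟩ := hM
  obtain ⟨s, t, rfl⟩ := exists_eq_isoVec ha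
  obtain ⟨x, y, rfl⟩ := exists_eq_isoVec hb
  refine evalAt_eq_zero_of_finite_compl
    (γ := fun x => N + vecMulVec (isoVec Complex.I s t) (isoVec Complex.I x y)) ?_
    (Set.finite_singleton 0) ?_ x
  · refine continuous_const.add (continuous_matrix fun i k => ?_)
    simp only [vecMulVec_apply]
    refine continuous_const.mul ?_
    fin_cases k <;> simp [isoVec] <;> fun_prop
  · intro x hx
    have hx : x ≠ 0 := hx
    -- `isoVec` is homogeneous of degree 2, so the factor `x²` moves from the second vector to the
    -- first.
    have : vecMulVec (isoVec Complex.I s t) (isoVec Complex.I x y) =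
        isoParam Complex.I (x * s) (x * t) (y / x) := by
      ext i k
      simp only [isoParam, vecMulVec_apply]
      fin_cases i <;> fin_cases k <;> simp [isoVec] <;> field_simp
    rw [this]
    exact h _ _ _

theorem ofSpinor_add_smul (A B : Matrix (Fin 4) (Fin 4) ℂ) (t : ℂ) :
    ofSpinor (A + t • B) = ofSpinor A + t • ofSpinor B := by
  ext i k
  fin_cases i <;> fin_cases k <;> simp [ofSpinor] <;> ring

/-- By `hp` and `hq` both `u + v` and `u - v` lie on the quadric, and `uvᵀ + vuᵀ` is half the
difference of their squares. -/
theorem exists_isotropicCone_add {u v : Fin 4 → ℂ}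
    (hp : u 0 * v 3 + v 0 * u 3 = u 1 * v 2 + v 1 * u 2)
    (hq : u 0 * u 3 - u 1 * u 2 + (v 0 * v 3 - v 1 * v 2) = 0) :
    ∃ M ∈ isotropicCone, ∃ N ∈ isotropicCone,
      ofSpinor (vecMulVec u v + vecMulVec v u) = M + N := by
  have key : ∀ (n : Fin 4 → ℂ) (c : ℂ), n 0 * n 3 = n 1 * n 2 →
      spinor Complex.I (ofSpinor (c • vecMulVec n n)) = c • vecMulVec n n := by
    intro n c hn
    apply spinor_ofSpinor
    · intro i k
      simp only [Matrix.smul_apply, vecMulVec_apply, mul_comm]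
    · simp only [Matrix.smul_apply, vecMulVec_apply, hn]
  have h1 : (u + v) 0 * (u + v) 3 = (u + v) 1 * (u + v) 2 := by
    simp only [Pi.add_apply]
    linear_combination hp + hq
  have h2 : (u - v) 0 * (u - v) 3 = (u - v) 1 * (u - v) 2 := by
    simp only [Pi.sub_apply]
    linear_combination -hp + hq
  refine ⟨ofSpinor ((1 / 2 : ℂ) • vecMulVec (u + v) (u + v)),
    mem_isotropicCone_of_spinor_eq h1 (key _ _ h1),
    ofSpinor ((-1 / 2 : ℂ) • vecMulVec (u - v) (u - v)),
    mem_isotropicCone_of_spinor_eq h2 (key _ _ h2), ?_⟩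
  apply spinor_injective
  rw [spinor_add, key _ _ h1, key _ _ h2, spinor_ofSpinor]
  · ext i k
    simp only [Matrix.add_apply, Matrix.smul_apply, vecMulVec_apply, Pi.add_apply, Pi.sub_apply,
      smul_eq_mul]
    ring
  · intro i k
    simp only [Matrix.add_apply, vecMulVec_apply]
    ring
  · simp only [Matrix.add_apply, vecMulVec_apply]
    linear_combination hp

theorem exists_isotropicCone_add_of_ne_zero {u v : Fin 4 → ℂ}
    (hp : u 0 * v 3 + v 0 * u 3 = u 1 * v 2 + v 1 * u 2)
    (hu : u 0 * u 3 - u 1 * u 2 ≠ 0) (hv : v 0 * v 3 - v 1 * v 2 ≠ 0) :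
    ∃ M ∈ isotropicCone, ∃ N ∈ isotropicCone,
      ofSpinor (vecMulVec u v + vecMulVec v u) = M + N := by
  -- Replacing `u`, `v` by `cu`, `c⁻¹v` keeps the symmetric product; the condition `c²q(u) + c⁻²q(v)
  -- = 0` asks for this fourth root.
  obtain ⟨c, hc⟩ := IsAlgClosed.exists_pow_nat_eq
    (-(v 0 * v 3 - v 1 * v 2) / (u 0 * u 3 - u 1 * u 2)) (n := 4) (by norm_num)
  have hc0 : c ≠ 0 := by
    rintro rfl
    rw [eq_div_iff hu] at hc
    apply hv
    linear_combination hc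
  have : vecMulVec u v + vecMulVec v u =
      vecMulVec (c • u) (c⁻¹ • v) + vecMulVec (c⁻¹ • v) (c • u) := by
    ext i k
    simp only [Matrix.add_apply, vecMulVec_apply, Pi.smul_apply, smul_eq_mul]
    field_simp
  rw [this]
  apply exists_isotropicCone_add
  · simp only [Pi.smul_apply, smul_eq_mul]
    field_simp
    linear_combination hp
  · simp only [Pi.smul_apply, smul_eq_mul]
    rw [eq_div_iff hu] at hc
    field_simp
    linear_combination hc

theorem exists_spinor_eq_of_mem_essentialCone {M : Matrix (Fin 3) (Fin 3) ℂ}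
    (hM : M ∈ essentialCone) :
    ∃ u v : Fin 4 → ℂ, spinor Complex.I M = vecMulVec u v + vecMulVec v u ∧
      u 0 * v 3 + v 0 * u 3 = u 1 * v 2 + v 1 * u 2 := by
  obtain ⟨u, v, huv⟩ := exists_eq_vecMulVec_add_vecMulVec (spinor_isSymm Complex.I M)
    (det_submatrix_eq_zero (spinor_minors hM))
  refine ⟨u, v, huv, ?_⟩
  have := spinor_apply_zero_three Complex.I M
  rw [huv] at this
  simpa only [Matrix.add_apply, vecMulVec_apply] using this

theorem finite_setOf_quadratic_eq_zero {a : ℂ} (ha : a ≠ 0) (b c : ℂ) :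
    {t : ℂ | c + t * b - t ^ 2 * a = 0}.Finite := by
  let p : Polynomial ℂ := Polynomial.C (-a) * Polynomial.X ^ 2 +
    Polynomial.C b * Polynomial.X + Polynomial.C c
  have hp0 : p ≠ 0 := by
    intro h0
    have := congrArg (fun p => Polynomial.coeff p 2) h0
    simp only [p, Polynomial.coeff_add, Polynomial.coeff_C_mul, Polynomial.coeff_X_pow,
      Polynomial.coeff_X, Polynomial.coeff_C, Polynomial.coeff_zero] at this
    norm_num at this
    exact ha this
  refine p.roots.toFinset.finite_toSet.subset fun t ht => ?_
  have ht : c + t * b - t ^ 2 * a = 0 := ht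
  simp only [Finset.mem_coe, Multiset.mem_toFinset, Polynomial.mem_roots hp0, Polynomial.IsRoot]
  simp [p]
  linear_combination ht

theorem evalAt_eq_zero_of_mem_essentialCone {f : Poly}
    (h : ∀ M ∈ isotropicCone, ∀ N ∈ isotropicCone, evalAt (M + N) f = 0)
    {M : Matrix (Fin 3) (Fin 3) ℂ} (hM : M ∈ essentialCone) : evalAt M f = 0 := by
  obtain ⟨u, v, huv, hp⟩ := exists_spinor_eq_of_mem_essentialCone hM
  rw [← ofSpinor_spinor M, huv]
  clear huv hM
  wlog H : v 0 * v 3 - v 1 * v 2 = 0 → u 0 * u 3 - u 1 * u 2 = 0 generalizing u v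
  · rw [add_comm]
    exact this v u (by linear_combination hp) (by tauto)
  by_cases hv : v 0 * v 3 - v 1 * v 2 = 0
  · obtain ⟨M, hM, N, hN, hMN⟩ := exists_isotropicCone_add hp (by rw [hv, H hv, add_zero])
    rw [hMN]
    exact h M hM N hN
  -- `w` is polar to `v` and `q(w) = -q(v) ≠ 0`. Moving `u` along `w` keeps orthogonality to `v` and
  -- makes `q` nonzero for all but finitely many `t`.
  let w : Fin 4 → ℂ := ![v 0, -v 1, v 2, -v 3]
  have hlin : ∀ t : ℂ, vecMulVec (u + t • w) v + vecMulVec v (u + t • w) =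
      (vecMulVec u v + vecMulVec v u) + t • (vecMulVec w v + vecMulVec v w) := by
    intro t
    ext i k
    simp only [Matrix.add_apply, vecMulVec_apply, Pi.add_apply, Pi.smul_apply, Matrix.smul_apply,
      smul_eq_mul]
    ring
  let B : ℂ := -u 0 * v 3 + v 0 * u 3 - u 1 * v 2 + v 1 * u 2
  have hB : ∀ t : ℂ, (u + t • w) 0 * (u + t • w) 3 - (u + t • w) 1 * (u + t • w) 2 =
      u 0 * u 3 - u 1 * u 2 + t * B - t ^ 2 * (v 0 * v 3 - v 1 * v 2) := by
    intro t
    simp [w, B]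
    ring
  have hfin := finite_setOf_quadratic_eq_zero hv B (u 0 * u 3 - u 1 * u 2)
  have := evalAt_eq_zero_of_finite_compl (f := f)
    (γ := fun t => ofSpinor (vecMulVec (u + t • w) v + vecMulVec v (u + t • w)))
    (by
      simp only [hlin, ofSpinor_add_smul]
      fun_prop) hfin
    (by
      intro t ht
      have hpt : (u + t • w) 0 * v 3 + v 0 * (u + t • w) 3 =
          (u + t • w) 1 * v 2 + v 1 * (u + t • w) 2 := by
        simp [w]
        linear_combination hp
      obtain ⟨M, hM, N, hN, hMN⟩ := exists_isotropicCone_add_of_ne_zero hpt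
        (by rw [hB]; exact ht) hv
      simp only [hMN]
      exact h M hM N hN) 0
  simpa using this

/-! ### From projective sets to cones: ideals, irreducibility, closedness -/

theorem evalAt_smul_of_isHomogeneous {f : Poly} {d : ℕ} (hf : f.IsHomogeneous d) (c : ℂ)
    (M : Matrix (Fin 3) (Fin 3) ℂ) : evalAt (c • M) f = c ^ d * evalAt M f := by
  unfold evalAt
  rw [MvPolynomial.eval_eq, MvPolynomial.eval_eq, Finset.mul_sum]
  refine Finset.sum_congr rfl fun m hm => ?_
  have hd : ∑ i ∈ m.support, m i = d := by
    have := hf (MvPolynomial.mem_support_iff.1 hm)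
    rw [Finsupp.weight_apply, Finsupp.sum] at this
    simpa using this
  simp only [Matrix.smul_apply, smul_eq_mul, mul_pow, Finset.prod_mul_distrib]
  rw [Finset.prod_pow_eq_pow_sum, hd]
  ring

theorem exists_rep_eq_smul {M : Matrix (Fin 3) (Fin 3) ℂ} (hM : M ≠ 0) :
    ∃ c : ℂ, c ≠ 0 ∧ (Projectivization.mk ℂ M hM).rep = c • M := by
  obtain ⟨a, ha⟩ := Projectivization.exists_smul_eq_mk_rep ℂ M hM
  exact ⟨a, a.ne_zero, ha.symm⟩

theorem mk_mem_iff_of_cone {X : Set PMat} {C : Set (Matrix (Fin 3) (Fin 3) ℂ)}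
    (hX : ∀ p, p ∈ X ↔ p.rep ∈ C) (hC : ∀ M ∈ C, ∀ c : ℂ, c • M ∈ C)
    {M : Matrix (Fin 3) (Fin 3) ℂ} (hM : M ≠ 0) : Projectivization.mk ℂ M hM ∈ X ↔ M ∈ C := by
  obtain ⟨c, hc, h⟩ := exists_rep_eq_smul hM
  rw [hX, h]
  refine ⟨fun h => ?_, fun h => hC _ h _⟩
  have := hC _ h c⁻¹
  rwa [smul_smul, inv_mul_cancel₀ hc, one_smul] at this

/-- The origin is included by continuity along a line of the cone. `hne` is essential here: for the
zero cone, constants vanish on the empty projective set but not at the origin. -/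
theorem mem_vanishingIdeal_iff_of_cone {X : Set PMat} {C : Set (Matrix (Fin 3) (Fin 3) ℂ)}
    (hX : ∀ p, p ∈ X ↔ p.rep ∈ C) (hC : ∀ M ∈ C, ∀ c : ℂ, c • M ∈ C) (hne : ∃ M ∈ C, M ≠ 0)
    {f : Poly} : f ∈ vanishingIdeal X ↔ ∀ M ∈ C, evalAt M f = 0 := by
  have h0 : f ∈ vanishingIdeal X ↔ ∀ M ∈ C, M ≠ 0 → evalAt M f = 0 :=
    ⟨fun h M hM h0 => h M h0 ((mk_mem_iff_of_cone hX hC h0).2 hM),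
      fun h M h0 hM => h M ((mk_mem_iff_of_cone hX hC h0).1 hM) h0⟩
  rw [h0]
  refine ⟨fun h M hM => ?_, fun h M hM _ => h M hM⟩
  by_cases hM0 : M = 0
  · obtain ⟨N, hN, hN0⟩ := hne
    rw [hM0]
    exact evalAt_zero_of_smul (M := N) fun c hc => h _ (hC _ hN c) (smul_ne_zero hc hN0)
  · exact h M hM hM0

theorem isZariskiIrreducible_of_isPrime {X : Set PMat} (hne : X.Nonempty)
    (hX : (vanishingIdeal X).IsPrime) : IsZariskiIrreducible X := by
  refine ⟨hne, ?_⟩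
  rintro Y Z ⟨F, hF, rfl⟩ ⟨G, hG, rfl⟩ hXYZ
  by_contra! hcon
  obtain ⟨hY, hZ⟩ := hcon
  obtain ⟨x, hx, hxY⟩ := Set.not_subset.1 hY
  obtain ⟨y, hy, hyZ⟩ := Set.not_subset.1 hZ
  have hxY : ¬ ∀ f ∈ F, evalAt x.rep f = 0 := hxY
  have hyZ : ¬ ∀ f ∈ G, evalAt y.rep f = 0 := hyZ
  push Not at hxY hyZ
  obtain ⟨f, hf, hfx⟩ := hxY
  obtain ⟨g, hg, hgy⟩ := hyZ
  have hfg : f * g ∈ vanishingIdeal X := by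
    intro M hM hMX
    obtain ⟨c, hc, hrep⟩ := exists_rep_eq_smul hM
    have key : ∀ {f : Poly} {d : ℕ}, f.IsHomogeneous d →
        evalAt (Projectivization.mk ℂ M hM).rep f = 0 → evalAt M f = 0 := by
      intro f d hd h
      rw [hrep, evalAt_smul_of_isHomogeneous hd] at h
      exact (mul_eq_zero.1 h).resolve_left (pow_ne_zero _ hc)
    have : evalAt M (f * g) = evalAt M f * evalAt M g := by simp [evalAt]
    rw [this, mul_eq_zero]
    rcases hXYZ hMX with h | h
    · exact Or.inl (key (hF f hf).choose_spec (h f hf))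
    · exact Or.inr (key (hG g hg).choose_spec (h g hg))
  rcases hX.mem_or_mem hfg with h | h
  · exact hfx (h x.rep x.rep_nonzero (by rwa [Projectivization.mk_rep]))
  · exact hgy (h y.rep y.rep_nonzero (by rwa [Projectivization.mk_rep]))

theorem mem_isotropicProducts_iff (p : PMat) : p ∈ isotropicProducts ↔ p.rep ∈ isotropicCone := by
  constructor
  · rintro ⟨a, b, h, ha, hb, rfl⟩
    obtain ⟨c, -, hc⟩ := exists_rep_eq_smul h
    rw [hc]
    exact smul_mem_isotropicCone ⟨a, b, ha, hb, rfl⟩ c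
  · rintro ⟨a, b, ha, hb, h⟩
    have h0 := p.rep_nonzero
    refine ⟨a, b, h ▸ h0, ha, hb, ?_⟩
    conv_lhs => rw [← p.mk_rep]
    simp only [h]

theorem mem_essentialVariety_iff (p : PMat) : p ∈ essentialVariety ↔ p.rep ∈ essentialCone :=
  Iff.rfl

theorem zero_mem_isotropicCone : (0 : Matrix (Fin 3) (Fin 3) ℂ) ∈ isotropicCone :=
  ⟨0, 0, by simp [Q], by simp [Q], by simp⟩

theorem isotropicCone_subset_essentialCone : isotropicCone ⊆ essentialCone := fun M hM => by
  simpa using add_mem_essentialCone hM zero_mem_isotropicCone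

theorem isoParam_ne_zero (t : ℂ) : isoParam Complex.I 1 0 t ≠ 0 := by
  intro h
  have h1 := congrFun (congrFun h 0) 0
  have h2 := congrFun (congrFun h 0) 1
  simp [isoParam, vecMulVec_apply, isoVec] at h1 h2
  have : (2 : ℂ) = 0 := by linear_combination h1 + h2
  norm_num at this

theorem mem_vanishingIdeal_isotropicProducts_iff {f : Poly} :
    f ∈ vanishingIdeal isotropicProducts ↔ ∀ M ∈ isotropicCone, evalAt M f = 0 :=
  mem_vanishingIdeal_iff_of_cone mem_isotropicProducts_iff
    (fun _ hM c => smul_mem_isotropicCone hM c) ⟨_, isoParam_mem 1 0 0, isoParam_ne_zero 0⟩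

theorem mem_vanishingIdeal_essentialVariety_iff {f : Poly} :
    f ∈ vanishingIdeal essentialVariety ↔ ∀ M ∈ essentialCone, evalAt M f = 0 :=
  mem_vanishingIdeal_iff_of_cone mem_essentialVariety_iff
    (fun _ hM c => smul_mem_essentialCone hM c)
    ⟨_, isotropicCone_subset_essentialCone (isoParam_mem 1 0 0), isoParam_ne_zero 0⟩

theorem mvPolynomialX_map_eval (M : Matrix (Fin 3) (Fin 3) ℂ) :
    (mvPolynomialX (Fin 3) (Fin 3) ℂ).map
      (MvPolynomial.eval fun ij : Fin 3 × Fin 3 => M ij.1 ij.2) = M := by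
  ext i k
  simp [mvPolynomialX]

theorem evalAt_apply_eq {P : Matrix (Fin 3) (Fin 3) Poly} (M : Matrix (Fin 3) (Fin 3) ℂ)
    (i k : Fin 3) : evalAt M (P i k) =
      P.map (MvPolynomial.eval fun ij : Fin 3 × Fin 3 => M ij.1 ij.2) i k := rfl

theorem isZariskiClosed_essentialVariety : IsZariskiClosed essentialVariety := by
  let X := mvPolynomialX (Fin 3) (Fin 3) ℂ
  have hX : ∀ i k, (X i k).IsHomogeneous 1 := fun i k => MvPolynomial.isHomogeneous_X _ _
  let P : Matrix (Fin 3) (Fin 3) Poly := (2 : Poly) • ((X * Xᵀ) * X) - (X * Xᵀ).trace • X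
  have hXX : ∀ i k, ((X * Xᵀ) i k).IsHomogeneous 2 := fun i k =>
    MvPolynomial.IsHomogeneous.sum _ _ _ fun l _ => (hX i l).mul (hX k l)
  have hP : ∀ i k, (P i k).IsHomogeneous 3 := by
    intro i k
    refine MvPolynomial.IsHomogeneous.sub ?_ ?_
    · have h2 : (2 : Poly).IsHomogeneous 0 := by
        rw [← map_ofNat MvPolynomial.C 2]
        exact MvPolynomial.isHomogeneous_C _ _
      have := h2.mul (MvPolynomial.IsHomogeneous.sum Finset.univ _ 3
        fun l _ => (hXX i l).mul (hX l k))
      rwa [zero_add] at this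
    · exact (MvPolynomial.IsHomogeneous.sum _ _ _ fun l _ => hXX l l).mul (hX i k)
  have hPe : ∀ M, P.map (MvPolynomial.eval fun ij : Fin 3 × Fin 3 => M ij.1 ij.2) =
      (2 : ℂ) • ((M * Mᵀ) * M) - (M * Mᵀ).trace • M := by
    intro M
    have h := mvPolynomialX_map_eval M
    conv_rhs => rw [← h]
    ext i k
    simp [P, X, Matrix.mul_apply, trace]
  refine ⟨{X.det} ∪ Set.range (fun ik : Fin 3 × Fin 3 => P ik.1 ik.2), ?_, ?_⟩
  · rintro f (rfl | ⟨ik, rfl⟩)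
    · refine ⟨3, ?_⟩
      rw [det_fin_three]
      have := fun i j k l m o => ((hX i j).mul (hX k l)).mul (hX m o)
      exact ((((((this _ _ _ _ _ _).sub (this _ _ _ _ _ _)).sub (this _ _ _ _ _ _)).add
        (this _ _ _ _ _ _)).add (this _ _ _ _ _ _)).sub (this _ _ _ _ _ _))
    · exact ⟨3, hP _ _⟩
  · ext p
    have hdet : evalAt p.rep X.det = p.rep.det := by
      conv_rhs => rw [← mvPolynomialX_map_eval p.rep]
      exact RingHom.map_det _ _
    rw [mem_essentialVariety_iff]
    constructor
    · rintro ⟨h1, h2⟩ f (rfl | ⟨ik, rfl⟩)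
      · rw [hdet, h1]
      · rw [evalAt_apply_eq, hPe, h2]
        rfl
    · intro h
      refine ⟨by rw [← hdet]; exact h _ (Or.inl rfl), ?_⟩
      rw [← hPe]
      ext i k
      exact h _ (Or.inr ⟨(i, k), rfl⟩)

/-- For `M = abᵀ` one has `MMᵀ = Q(b) aaᵀ` and `MᵀM = Q(a) bbᵀ`; together with the `2 × 2` minors
this gives quadratic equations for the cone. -/
theorem mem_isotropicCone_iff {M : Matrix (Fin 3) (Fin 3) ℂ} :
    M ∈ isotropicCone ↔ (∀ i j k l, M i k * M j l - M i l * M j k = 0) ∧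
      (∀ i k, (M * Mᵀ) i k = 0) ∧ ∀ i k, (Mᵀ * M) i k = 0 := by
  constructor
  · rintro ⟨a, b, ha, hb, rfl⟩
    rw [Q_eq_dotProduct] at ha hb
    refine ⟨fun i j k l => ?_, fun i k => ?_, fun i k => ?_⟩
    · simp only [vecMulVec_apply]
      ring
    · simp [transpose_vecMulVec, vecMulVec_mul_vecMulVec, hb]
    · simp [transpose_vecMulVec, vecMulVec_mul_vecMulVec, ha]
  · rintro ⟨h1, h2, h3⟩
    by_cases h0 : M = 0
    · rw [h0]
      exact zero_mem_isotropicCone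
    · obtain ⟨k, l, hkl⟩ : ∃ k l, M k l ≠ 0 := by
        by_contra! h
        exact h0 (by ext i j; simp [h])
      -- The column and the normalized row through a nonzero entry.
      refine ⟨fun i => M i l, fun j => M k j / M k l, ?_, ?_, ?_⟩
      · have := h3 l l
        simp only [Matrix.mul_apply, transpose_apply, Fin.sum_univ_three] at this
        simp only [Q]
        linear_combination this
      · have := h2 k k
        simp only [Matrix.mul_apply, transpose_apply, Fin.sum_univ_three] at this
        simp only [Q]
        field_simp
        linear_combination this
      · ext i j
        simp only [vecMulVec_apply]
        field_simp
        linear_combination -h1 i k l j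

theorem isZariskiClosed_isotropicProducts : IsZariskiClosed isotropicProducts := by
  let X := mvPolynomialX (Fin 3) (Fin 3) ℂ
  have hX : ∀ i k, (X i k).IsHomogeneous 1 := fun i k => MvPolynomial.isHomogeneous_X _ _
  refine ⟨{f | (∃ i j k l, f = X i k * X j l - X i l * X j k) ∨ (∃ i k, f = (X * Xᵀ) i k) ∨
    ∃ i k, f = (Xᵀ * X) i k}, ?_, ?_⟩
  · rintro f (⟨i, j, k, l, rfl⟩ | ⟨i, k, rfl⟩ | ⟨i, k, rfl⟩)
    · exact ⟨2, ((hX i k).mul (hX j l)).sub ((hX i l).mul (hX j k))⟩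
    · exact ⟨2, MvPolynomial.IsHomogeneous.sum _ _ _ fun l _ => (hX i l).mul (hX k l)⟩
    · exact ⟨2, MvPolynomial.IsHomogeneous.sum _ _ _ fun l _ => (hX l i).mul (hX l k)⟩
  · ext p
    rw [mem_isotropicProducts_iff, mem_isotropicCone_iff]
    have e1 : ∀ i j k l, evalAt p.rep (X i k * X j l - X i l * X j k) =
        p.rep i k * p.rep j l - p.rep i l * p.rep j k := by
      intro i j k l
      simp [evalAt, X]
    have e2 : ∀ i k, evalAt p.rep ((X * Xᵀ) i k) = (p.rep * p.repᵀ) i k := by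
      intro i k
      simp [evalAt, X, Matrix.mul_apply]
    have e3 : ∀ i k, evalAt p.rep ((Xᵀ * X) i k) = (p.repᵀ * p.rep) i k := by
      intro i k
      simp [evalAt, X, Matrix.mul_apply]
    constructor
    · rintro ⟨h1, h2, h3⟩ f (⟨i, j, k, l, rfl⟩ | ⟨i, k, rfl⟩ | ⟨i, k, rfl⟩)
      · rw [e1, h1]
      · rw [e2, h2]
      · rw [e3, h3]
    · intro h
      refine ⟨fun i j k l => ?_, fun i k => ?_, fun i k => ?_⟩
      · rw [← e1]
        exact h _ (Or.inl ⟨i, j, k, l, rfl⟩)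
      · rw [← e2]
        exact h _ (Or.inr (Or.inl ⟨i, k, rfl⟩))
      · rw [← e3]
        exact h _ (Or.inr (Or.inr ⟨i, k, rfl⟩))

/-! ### Generic points and dimensions -/

/-- Substitution of the entries of a matrix of polynomials. -/
noncomputable def pullback {n : ℕ} (A : Matrix (Fin 3) (Fin 3) (MvPolynomial (Fin n) ℂ)) :
    Poly →ₐ[ℂ] MvPolynomial (Fin n) ℂ :=
  MvPolynomial.aeval fun ij => A ij.1 ij.2

theorem eval_algHom {σ τ : Type*} (θ : MvPolynomial σ ℂ →ₐ[ℂ] MvPolynomial τ ℂ) (z : τ → ℂ)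
    (f : MvPolynomial σ ℂ) : MvPolynomial.eval z (θ f) =
      MvPolynomial.eval (fun i => MvPolynomial.eval z (θ (MvPolynomial.X i))) f := by
  induction f using MvPolynomial.induction_on with
  | C a => simp [MvPolynomial.algHom_C]
  | add p q hp hq => simp [hp, hq]
  | mul_X p i hp => simp [hp]

theorem eval_pullback {n : ℕ} (A : Matrix (Fin 3) (Fin 3) (MvPolynomial (Fin n) ℂ))
    (z : Fin n → ℂ) (f : Poly) :
    MvPolynomial.eval z (pullback A f) = evalAt (A.map (MvPolynomial.eval z)) f := by
  rw [eval_algHom]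
  simp [pullback, evalAt]

theorem mem_ker_pullback_iff {n : ℕ} {A : Matrix (Fin 3) (Fin 3) (MvPolynomial (Fin n) ℂ)}
    {f : Poly} : f ∈ RingHom.ker (pullback A) ↔
      ∀ z, evalAt (A.map (MvPolynomial.eval z)) f = 0 := by
  rw [RingHom.mem_ker]
  simp only [← eval_pullback]
  exact ⟨fun h z => by rw [h, map_zero], fun h => MvPolynomial.funext fun z => by
    rw [h z, map_zero]⟩

theorem isoParam_map {R S : Type*} [CommRing R] [CommRing S] (φ : R →+* S) (j a b t : R) :
    (isoParam j a b t).map φ = isoParam (φ j) (φ a) (φ b) (φ t) := by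
  ext i k
  fin_cases i <;> fin_cases k <;> simp [isoParam, isoVec, vecMulVec_apply, map_ofNat φ 2]

/-- The generic point of the parametrization of `isotropicCone`. -/
noncomputable def isotropicGeneric : Matrix (Fin 3) (Fin 3) (MvPolynomial (Fin 3) ℂ) :=
  isoParam (MvPolynomial.C Complex.I) (.X 0) (.X 1) (.X 2)

/-- The generic point of the parametrization of `essentialCone` by sums of two isotropic
products. -/
noncomputable def essentialGeneric : Matrix (Fin 3) (Fin 3) (MvPolynomial (Fin 6) ℂ) :=
  isoParam (MvPolynomial.C Complex.I) (.X 0) (.X 1) (.X 2) +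
    isoParam (MvPolynomial.C Complex.I) (.X 3) (.X 4) (.X 5)

theorem isotropicGeneric_map_eval (z : Fin 3 → ℂ) :
    isotropicGeneric.map (MvPolynomial.eval z) = isoParam Complex.I (z 0) (z 1) (z 2) := by
  simp [isotropicGeneric, isoParam_map]

theorem essentialGeneric_map_eval (z : Fin 6 → ℂ) :
    essentialGeneric.map (MvPolynomial.eval z) =
      isoParam Complex.I (z 0) (z 1) (z 2) + isoParam Complex.I (z 3) (z 4) (z 5) := by
  rw [essentialGeneric, Matrix.map_add _ (map_add _)]
  simp [isoParam_map]

theorem vanishingIdeal_isotropicProducts :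
    vanishingIdeal isotropicProducts = RingHom.ker (pullback isotropicGeneric) := by
  ext f
  rw [mem_vanishingIdeal_isotropicProducts_iff, mem_ker_pullback_iff]
  simp only [isotropicGeneric_map_eval]
  refine ⟨fun h z => h _ (isoParam_mem _ _ _), fun h M hM => ?_⟩
  rw [← zero_add M]
  refine evalAt_add_eq_zero_of_isoParam (fun a b t => ?_) hM
  rw [zero_add]
  exact h ![a, b, t]

theorem vanishingIdeal_essentialVariety :
    vanishingIdeal essentialVariety = RingHom.ker (pullback essentialGeneric) := by
  ext f
  rw [mem_vanishingIdeal_essentialVariety_iff, mem_ker_pullback_iff]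
  simp only [essentialGeneric_map_eval]
  refine ⟨fun h z => h _ (add_mem_essentialCone (isoParam_mem _ _ _) (isoParam_mem _ _ _)),
    fun h M hM => ?_⟩
  refine evalAt_eq_zero_of_mem_essentialCone (fun M hM N hN => ?_) hM
  refine evalAt_add_eq_zero_of_isoParam (fun a b t => ?_) hN
  rw [add_comm]
  refine evalAt_add_eq_zero_of_isoParam (fun a' b' t' => ?_) hM
  exact h ![a, b, t, a', b', t']

/-- If `θ p = 0`, then `p` vanishes on the image of the polynomial map, which contains the locus `D
≠ 0`; hence `D * p = 0`. -/
theorem injective_of_dominant {n : ℕ}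
    (θ : MvPolynomial (Fin n) ℂ →ₐ[ℂ] MvPolynomial (Fin n) ℂ) {D : MvPolynomial (Fin n) ℂ}
    (hD : D ≠ 0) (h : ∀ x, MvPolynomial.eval x D ≠ 0 →
      ∃ z, ∀ i, MvPolynomial.eval z (θ (.X i)) = x i) : Function.Injective θ := by
  rw [injective_iff_map_eq_zero]
  intro p hp
  have : D * p = 0 := by
    apply MvPolynomial.funext
    intro x
    rw [map_mul, map_zero, mul_eq_zero, or_iff_not_imp_left]
    intro hx
    obtain ⟨z, hz⟩ := h x hx
    have := eval_algHom θ z p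
    simp only [hz, hp, map_zero] at this
    exact this.symm
  exact (mul_eq_zero.1 this).resolve_left hD

/-- The entries of `spinor`, as linear polynomials in the entries of the matrix. -/
noncomputable def spinorCoord (i k : Fin 4) : Poly :=
  MvPolynomial.C (1 / 4) * spinor (MvPolynomial.C Complex.I) (mvPolynomialX (Fin 3) (Fin 3) ℂ) i k

theorem evalAt_spinorCoord (M : Matrix (Fin 3) (Fin 3) ℂ) (i k : Fin 4) :
    evalAt M (spinorCoord i k) = 1 / 4 * spinor Complex.I M i k := by
  have := congrFun (congrFun (spinor_map
    (MvPolynomial.eval fun ij : Fin 3 × Fin 3 => M ij.1 ij.2) (MvPolynomial.C Complex.I)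
    (mvPolynomialX (Fin 3) (Fin 3) ℂ)) i) k
  rw [mvPolynomialX_map_eval, MvPolynomial.eval_C, map_apply] at this
  rw [← this, spinorCoord, evalAt, map_mul, MvPolynomial.eval_C]

theorem spinor_isoParam (a b t : ℂ) : spinor Complex.I (isoParam Complex.I a b t) =
    (4 : ℂ) • vecMulVec ![a, a * t, b, b * t] ![a, a * t, b, b * t] := by
  rw [isoParam, spinor_vecMulVec_isoVec]
  simp

/-- On the parametrization the three chosen coordinates are `a²`, `ab`, `a²t`, which reach every
point with first coordinate nonzero. -/
theorem ringKrullDim_isotropicProducts :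
    ringKrullDim (Poly ⧸ vanishingIdeal isotropicProducts) = (3 : ℕ) := by
  rw [vanishingIdeal_isotropicProducts]
  refine ringKrullDim_quotient_ker_of_comp_injective _
    (MvPolynomial.aeval ![spinorCoord 0 0, spinorCoord 0 2, spinorCoord 0 1])
    (injective_of_dominant _ (MvPolynomial.X_ne_zero (0 : Fin 3)) ?_)
  intro x hx
  rw [MvPolynomial.eval_X] at hx
  obtain ⟨a, ha⟩ := IsAlgClosed.exists_pow_nat_eq (x 0) zero_lt_two
  have ha0 : a ≠ 0 := by
    rintro rfl
    exact hx (by rw [← ha]; simp)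
  refine ⟨![a, x 1 / a, x 2 / a ^ 2], fun i => ?_⟩
  rw [AlgHom.comp_apply, eval_pullback, isotropicGeneric_map_eval, MvPolynomial.aeval_X]
  fin_cases i <;>
    simp [evalAt_spinorCoord, spinor_isoParam] <;> field_simp
  exact ha

theorem exists_eq_sq_mul_sq {x y z : ℂ} (h : x * z = y ^ 2) :
    ∃ a b : ℂ, x = a ^ 2 ∧ y = a * b ∧ z = b ^ 2 := by
  obtain ⟨a, rfl⟩ := IsAlgClosed.exists_pow_nat_eq x zero_lt_two
  by_cases ha : a = 0
  · obtain ⟨b, rfl⟩ := IsAlgClosed.exists_pow_nat_eq z zero_lt_two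
    refine ⟨a, b, rfl, ?_, rfl⟩
    have : y ^ 2 = 0 := by rw [← h, ha]; ring
    rw [ha, zero_mul]
    simpa using this
  · refine ⟨a, y / a, rfl, by field_simp, ?_⟩
    field_simp
    linear_combination h

/-- A general pair of vectors `x, y ∈ ℂ³` lies on a secant line of the conic `v₀v₂ = v₁²`. -/
theorem exists_conic_points {x y : Fin 3 → ℂ} (h1 : x 0 * x 2 - x 1 ^ 2 ≠ 0)
    (h2 : (x 0 * y 2 + x 2 * y 0 - 2 * x 1 * y 1) ^ 2 -
      4 * (x 0 * x 2 - x 1 ^ 2) * (y 0 * y 2 - y 1 ^ 2) ≠ 0) :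
    ∃ a b t a' b' t' : ℂ, x = ![a ^ 2, a * b, b ^ 2] + ![a' ^ 2, a' * b', b' ^ 2] ∧
      y = t • ![a ^ 2, a * b, b ^ 2] + t' • ![a' ^ 2, a' * b', b' ^ 2] := by
  obtain ⟨δ, hδ⟩ := IsAlgClosed.exists_pow_nat_eq
    ((x 0 * y 2 + x 2 * y 0 - 2 * x 1 * y 1) ^ 2 -
      4 * (x 0 * x 2 - x 1 ^ 2) * (y 0 * y 2 - y 1 ^ 2)) zero_lt_two
  have hδ0 : δ ≠ 0 := by
    rintro rfl
    exact h2 (by rw [← hδ]; simp)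
  set B := x 0 * y 2 + x 2 * y 0 - 2 * x 1 * y 1 with hB
  set A := x 0 * x 2 - x 1 ^ 2 with hA
  have key : ∀ t : ℂ, (2 * A * t - B) ^ 2 = δ ^ 2 → ∀ c : ℂ,
      ∃ a b : ℂ, c • (y - t • x) = ![a ^ 2, a * b, b ^ 2] := by
    intro t ht c
    have h3 : (y 0 - t * x 0) * (y 2 - t * x 2) = (y 1 - t * x 1) ^ 2 := by
      have : A * ((y 0 - t * x 0) * (y 2 - t * x 2) - (y 1 - t * x 1) ^ 2) = 0 := by
        rw [hδ] at ht
        rw [hA, hB] at *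
        linear_combination ht / 4
      linear_combination (mul_eq_zero.1 this).resolve_left h1
    obtain ⟨a, b, ha, hab, hb⟩ := exists_eq_sq_mul_sq (x := c * (y 0 - t * x 0))
      (y := c * (y 1 - t * x 1)) (z := c * (y 2 - t * x 2)) (by linear_combination c ^ 2 * h3)
    refine ⟨a, b, ?_⟩
    ext i
    fin_cases i <;> simp [ha, hab, hb]
  -- Reading `x`, `y` as symmetric `2 × 2` matrices, `t` and `t'` are the roots of `det (y - s x) =
  -- 0`; there `y - s x` has rank one, hence lies on the conic.
  set t := (B + δ) / (2 * A) with ht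
  set t' := (B - δ) / (2 * A) with ht'
  have htt : t - t' ≠ 0 := by
    have : t - t' = δ / A := by
      rw [ht, ht']
      field_simp
      ring
    rw [this]
    exact div_ne_zero hδ0 h1
  obtain ⟨a, b, hab⟩ := key t' (by rw [ht']; field_simp; ring) (t - t')⁻¹
  obtain ⟨a', b', hab'⟩ := key t (by rw [ht]; field_simp; ring) (-(t - t')⁻¹)
  refine ⟨a, b, t, a', b', t', ?_, ?_⟩ <;> rw [← hab, ← hab'] <;> ext i <;>
    simp only [Pi.add_apply, Pi.smul_apply, Pi.sub_apply, smul_eq_mul] <;> field_simp <;> ring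

/-- The six coordinates form two triples: a sum of two conic points `(a², ab, b²)`, and the same sum
weighted by `t` and `t'`. By `exists_conic_points` they are arbitrary off the discriminant locus `D
= 0`. -/
theorem ringKrullDim_essentialVariety :
    ringKrullDim (Poly ⧸ vanishingIdeal essentialVariety) = (6 : ℕ) := by
  rw [vanishingIdeal_essentialVariety]
  let X : Fin 6 → MvPolynomial (Fin 6) ℂ := MvPolynomial.X
  let A := X 0 * X 2 - X 1 ^ 2
  let D := A * ((X 0 * X 5 + X 2 * X 3 - 2 * X 1 * X 4) ^ 2 - 4 * A * (X 3 * X 5 - X 4 ^ 2))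
  have hD : D ≠ 0 := by
    intro h
    have := congrArg (MvPolynomial.eval ![1, 0, 1, 0, 0, 1]) h
    simp [D, A, X] at this
  refine ringKrullDim_quotient_ker_of_comp_injective _
    (MvPolynomial.aeval ![spinorCoord 0 0, spinorCoord 0 2, spinorCoord 2 2,
      spinorCoord 0 1, spinorCoord 0 3, spinorCoord 2 3])
    (injective_of_dominant _ hD ?_)
  intro x hx
  simp only [D, A, X, map_mul, map_sub, map_add, map_pow, MvPolynomial.eval_X, map_ofNat] at hx
  obtain ⟨h1, h2⟩ := mul_ne_zero_iff.1 hx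
  obtain ⟨a, b, t, a', b', t', hX, hY⟩ :=
    exists_conic_points (x := ![x 0, x 1, x 2]) (y := ![x 3, x 4, x 5]) h1 h2
  have e0 := congrFun hX 0
  have e1 := congrFun hX 1
  have e2 := congrFun hX 2
  have e3 := congrFun hY 0
  have e4 := congrFun hY 1
  have e5 := congrFun hY 2
  simp at e0 e1 e2 e3 e4 e5
  refine ⟨![a, b, t, a', b', t'], fun i => ?_⟩
  rw [AlgHom.comp_apply, eval_pullback, essentialGeneric_map_eval, MvPolynomial.aeval_X]
  fin_cases i <;>
    simp [evalAt_spinorCoord, spinor_add, spinor_isoParam, e0, e1, e2, e3, e4, e5]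
    <;> ring

theorem isProjectiveSurface_isotropicProducts : IsProjectiveSurface isotropicProducts := by
  refine ⟨isZariskiClosed_isotropicProducts, isZariskiIrreducible_of_isPrime ?_ ?_,
    ringKrullDim_isotropicProducts⟩
  · exact ⟨.mk ℂ _ (isoParam_ne_zero 0),
      (mk_mem_iff_of_cone mem_isotropicProducts_iff
        (fun _ hM c => smul_mem_isotropicCone hM c) _).2 (isoParam_mem 1 0 0)⟩
  · rw [vanishingIdeal_isotropicProducts]
    exact RingHom.ker_isPrime _

/-- The vanishing ideal is prime, so it is its own only minimal prime and the local dimension is the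
global one. -/
theorem coneLocalDim_essentialVariety {p : PMat} (hp : p ∈ essentialVariety) :
    coneLocalDim essentialVariety p = (6 : ℕ) := by
  have hprime : (vanishingIdeal essentialVariety).IsPrime := by
    rw [vanishingIdeal_essentialVariety]
    exact RingHom.ker_isPrime _
  rw [coneLocalDim, ← ringKrullDim_essentialVariety]
  apply le_antisymm
  · refine iSup_le fun q => ?_
    have : q.1 = vanishingIdeal essentialVariety := by
      have hmin := Ideal.minimalPrimes_eq_subsingleton_self (I := vanishingIdeal essentialVariety)
      exact hmin.subset q.2.1
    rw [this]
  · refine le_iSup_of_le ⟨vanishingIdeal essentialVariety, ?_, fun f hf =>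
      mem_vanishingIdeal_essentialVariety_iff.1 hf _ hp⟩ le_rfl
    rw [Ideal.minimalPrimes_eq_subsingleton_self]
    rfl

/-! ### The secant variety -/

theorem secondSecantVariety_isotropicProducts :
    secondSecantVariety isotropicProducts = essentialVariety := by
  have hmk : ∀ {M : Matrix (Fin 3) (Fin 3) ℂ} (hM : M ≠ 0), M ∈ isotropicCone →
      Projectivization.mk ℂ M hM ∈ isotropicProducts := fun hM h =>
    (mk_mem_iff_of_cone mem_isotropicProducts_iff
      (fun _ hM c => smul_mem_isotropicCone hM c) hM).2 h
  apply Set.Subset.antisymm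
  · apply Set.sInter_subset_of_mem
    refine ⟨isZariskiClosed_essentialVariety, ?_⟩
    rintro p ⟨x, hx, y, hy, -, hp⟩
    rw [Projectivization.submodule_eq, Projectivization.submodule_eq,
      Projectivization.submodule_eq, Submodule.span_singleton_le_iff_mem, Submodule.mem_sup] at hp
    obtain ⟨M, hM, N, hN, hMN⟩ := hp
    obtain ⟨a, rfl⟩ := Submodule.mem_span_singleton.1 hM
    obtain ⟨b, rfl⟩ := Submodule.mem_span_singleton.1 hN
    rw [mem_essentialVariety_iff, ← hMN]
    rw [mem_isotropicProducts_iff] at hx hy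
    exact add_mem_essentialCone (smul_mem_isotropicCone hx a) (smul_mem_isotropicCone hy b)
  · intro p hp
    rw [mem_essentialVariety_iff] at hp
    refine Set.mem_sInter.2 ?_
    rintro Y ⟨⟨F, hF, rfl⟩, hY⟩
    intro f hf
    obtain ⟨d, hd⟩ := hF f hf
    -- `f` vanishes on every matrix that lies on a secant line
    have hsec : ∀ (M : Matrix (Fin 3) (Fin 3) ℂ) (hM : M ≠ 0) (x y : PMat),
        x ∈ isotropicProducts → y ∈ isotropicProducts → x ≠ y →
        M ∈ x.submodule ⊔ y.submodule → evalAt M f = 0 := by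
      intro M hM x y hx hy hxy hMxy
      have h1 := hY (show Projectivization.mk ℂ M hM ∈ _ from ⟨x, hx, y, hy, hxy, by
        rwa [Projectivization.submodule_mk, Submodule.span_singleton_le_iff_mem]⟩) f hf
      obtain ⟨c, hc, hrep⟩ := exists_rep_eq_smul hM
      rw [hrep, evalAt_smul_of_isHomogeneous hd] at h1
      exact (mul_eq_zero.1 h1).resolve_left (pow_ne_zero _ hc)
    -- Secants need two distinct points. Any isotropic product differs from at least one of these
    -- two fixed ones, so it lies on a genuine secant.
    have hne : Projectivization.mk ℂ _ (isoParam_ne_zero 0) ≠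
        Projectivization.mk ℂ _ (isoParam_ne_zero 1) := by
      rw [Ne, Projectivization.mk_eq_mk_iff']
      rintro ⟨a, ha⟩
      have h1 := congrFun (congrFun ha 0) 2
      have h2 := congrFun (congrFun ha 0) 1
      simp [isoParam, vecMulVec_apply, isoVec] at h1 h2
      simp [h1] at h2
      exact Complex.I_ne_zero h2.symm
    have hiso : ∀ M ∈ isotropicCone, M ≠ 0 → evalAt M f = 0 := by
      intro M hM hM0
      by_cases h : Projectivization.mk ℂ M hM0 = Projectivization.mk ℂ _ (isoParam_ne_zero 0)
      · refine hsec M hM0 _ _ (hmk hM0 hM) (hmk _ (isoParam_mem 1 0 1)) (h ▸ hne) ?_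
        exact Submodule.mem_sup_left (by
          rw [Projectivization.submodule_mk]; exact Submodule.mem_span_singleton_self _)
      · refine hsec M hM0 _ _ (hmk hM0 hM) (hmk _ (isoParam_mem 1 0 0)) h ?_
        exact Submodule.mem_sup_left (by
          rw [Projectivization.submodule_mk]; exact Submodule.mem_span_singleton_self _)
    have hiso' : ∀ M ∈ isotropicCone, evalAt M f = 0 := by
      intro M hM
      by_cases hM0 : M = 0
      · rw [hM0]
        exact evalAt_zero_of_smul (M := isoParam Complex.I 1 0 0) fun c hc =>
          hiso _ (smul_mem_isotropicCone (isoParam_mem 1 0 0) c)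
            (smul_ne_zero hc (isoParam_ne_zero 0))
      · exact hiso M hM hM0
    refine evalAt_eq_zero_of_mem_essentialCone (fun M hM N hN => ?_) hp
    by_cases hM0 : M = 0
    · rw [hM0, zero_add]
      exact hiso' N hN
    by_cases hN0 : N = 0
    · rw [hN0, add_zero]
      exact hiso' M hM
    by_cases hMN : Projectivization.mk ℂ M hM0 = Projectivization.mk ℂ N hN0
    · obtain ⟨a, rfl⟩ := (Projectivization.mk_eq_mk_iff' ..).1 hMN
      have : a • N + N = (a + 1) • N := by rw [add_smul, one_smul]
      rw [this]
      exact hiso' _ (smul_mem_isotropicCone hN _)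
    by_cases h0 : M + N = 0
    · rw [h0]
      exact hiso' 0 zero_mem_isotropicCone
    · refine hsec _ h0 _ _ (hmk hM0 hM) (hmk hN0 hN) hMN ?_
      rw [Projectivization.submodule_mk, Projectivization.submodule_mk]
      exact Submodule.add_mem_sup (Submodule.mem_span_singleton_self _)
        (Submodule.mem_span_singleton_self _)

/-! ### Tangent spaces and the singular locus -/

theorem hasDerivAt_evalAt_add_smul (M V : Matrix (Fin 3) (Fin 3) ℂ) (f : Poly) :
    HasDerivAt (fun t : ℂ => evalAt (M + t • V) f)
      (∑ ij : Fin 3 × Fin 3, evalAt M (MvPolynomial.pderiv ij f) * V ij.1 ij.2) 0 := by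
  induction f using MvPolynomial.induction_on with
  | C a => simpa [evalAt] using hasDerivAt_const (0 : ℂ) a
  | add p q hp hq =>
    have := hp.add hq
    simp only [evalAt, map_add, add_mul, Finset.sum_add_distrib] at this ⊢
    exact this
  | mul_X p ij hp =>
    have hX : HasDerivAt (fun t : ℂ => M ij.1 ij.2 + t * V ij.1 ij.2) (V ij.1 ij.2) 0 := by
      simpa using ((hasDerivAt_id (0 : ℂ)).mul_const (V ij.1 ij.2)).const_add (M ij.1 ij.2)
    have h := hp.mul hX
    have he : (fun t : ℂ => evalAt (M + t • V) (p * MvPolynomial.X ij)) =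
        (fun t : ℂ => evalAt (M + t • V) p) * fun t : ℂ => M ij.1 ij.2 + t * V ij.1 ij.2 := by
      ext t
      simp [evalAt]
    rw [he]
    refine h.congr_deriv ?_
    symm
    simp only [Derivation.leibniz, MvPolynomial.pderiv_X, smul_eq_mul, evalAt, map_add, map_mul,
      MvPolynomial.eval_X, zero_smul, add_zero, zero_mul, add_mul, Finset.sum_add_distrib,
      Finset.sum_mul]
    rw [add_comm]
    congr 1
    · refine Finset.sum_congr rfl fun kl _ => ?_
      ring
    · rw [Finset.sum_eq_single ij]
      · simp
      · intro b _ hb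
        simp [hb.symm]
      · simp

theorem mem_coneTangentSpace_iff {X : Set PMat} {p : PMat} {V : Matrix (Fin 3) (Fin 3) ℂ} :
    V ∈ coneTangentSpace X p ↔ ∀ f ∈ vanishingIdeal X,
      HasDerivAt (fun t : ℂ => evalAt (p.rep + t • V) f) 0 0 := by
  refine ⟨fun h f hf => ?_, fun h f hf => ?_⟩
  · have := hasDerivAt_evalAt_add_smul p.rep V f
    rwa [h f hf] at this
  · exact (hasDerivAt_evalAt_add_smul p.rep V f).unique (h f hf)

theorem exists_isotropic_sum (x : Fin 3 → ℂ) :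
    ∃ p q r : Fin 3 → ℂ, Q p = 0 ∧ Q q = 0 ∧ Q r = 0 ∧ x = p + q + r := by
  have hI := Complex.I_sq
  refine ⟨(-Complex.I * x 2) • ![1, 0, Complex.I],
    ((x 0 + Complex.I * x 2 - Complex.I * x 1) / 2) • ![1, Complex.I, 0],
    ((x 0 + Complex.I * x 2 + Complex.I * x 1) / 2) • ![1, -Complex.I, 0], ?_, ?_, ?_, ?_⟩
  · simp [Q, mul_pow]
  · simp [Q, mul_pow]
  · simp [Q, mul_pow]
  · ext i
    fin_cases i <;> simp <;> ring_nf <;> simp [hI]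

/-- For isotropic `V` the whole line `p.rep + t • V` stays in the essential cone, so `V` is tangent.
Isotropic vectors span `ℂ³`, hence their products span all matrices. -/
theorem coneTangentSpace_eq_top {p : PMat} (hp : p ∈ isotropicProducts) :
    coneTangentSpace essentialVariety p = ⊤ := by
  rw [mem_isotropicProducts_iff] at hp
  have hiso : ∀ V ∈ isotropicCone, V ∈ coneTangentSpace essentialVariety p := by
    intro V hV
    rw [mem_coneTangentSpace_iff]
    intro f hf
    rw [mem_vanishingIdeal_essentialVariety_iff] at hf
    have : (fun t : ℂ => evalAt (p.rep + t • V) f) = fun _ => 0 := by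
      ext t
      exact hf _ (add_mem_essentialCone hp (smul_mem_isotropicCone hV t))
    rw [this]
    exact hasDerivAt_const _ _
  have hvec : ∀ a b : Fin 3 → ℂ, vecMulVec a b ∈ coneTangentSpace essentialVariety p := by
    intro a b
    obtain ⟨a1, a2, a3, h1, h2, h3, rfl⟩ := exists_isotropic_sum a
    obtain ⟨b1, b2, b3, k1, k2, k3, rfl⟩ := exists_isotropic_sum b
    simp only [vecMulVec_add, add_vecMulVec]
    have := fun {a b : Fin 3 → ℂ} (ha : Q a = 0) (hb : Q b = 0) =>
      hiso (vecMulVec a b) ⟨a, b, ha, hb, rfl⟩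
    exact add_mem (add_mem (add_mem (add_mem (this h1 k1) (this h2 k1)) (this h3 k1))
      (add_mem (add_mem (this h1 k2) (this h2 k2)) (this h3 k2)))
      (add_mem (add_mem (this h1 k3) (this h2 k3)) (this h3 k3))
  rw [eq_top_iff]
  intro V _
  have : V = ∑ k, vecMulVec (fun i => V i k) (Pi.single k 1) := by
    ext i j
    simp [Matrix.sum_apply, vecMulVec_apply, Pi.single_apply]
  rw [this]
  exact sum_mem fun k _ => hvec _ _

/-- The determinant of the matrix of the values of `spinor` on the rows of `A`
and of `B`, as a polynomial. -/
noncomputable def spinorMinor (A B : Matrix (Fin 3) (Fin 4) ℂ) : Poly :=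
  ((A.map MvPolynomial.C : Matrix (Fin 3) (Fin 4) Poly) * spinor (MvPolynomial.C Complex.I) (mvPolynomialX (Fin 3) (Fin 3) ℂ) *
    (Bᵀ.map MvPolynomial.C : Matrix (Fin 4) (Fin 3) Poly)).det

theorem evalAt_spinorMinor (A B : Matrix (Fin 3) (Fin 4) ℂ) (M : Matrix (Fin 3) (Fin 3) ℂ) :
    evalAt M (spinorMinor A B) = (A * spinor Complex.I M * Bᵀ).det := by
  rw [evalAt, spinorMinor, RingHom.map_det, RingHom.mapMatrix_apply, Matrix.map_mul, Matrix.map_mul,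
    spinor_map, mvPolynomialX_map_eval]
  congr
  · ext i k
    simp
  · simp
  · ext i k
    simp

theorem spinorMinor_mem (A B : Matrix (Fin 3) (Fin 4) ℂ) :
    spinorMinor A B ∈ vanishingIdeal essentialVariety := by
  rw [mem_vanishingIdeal_essentialVariety_iff]
  intro M hM
  obtain ⟨u, v, huv, -⟩ := exists_spinor_eq_of_mem_essentialCone hM
  rw [evalAt_spinorMinor, huv, Matrix.mul_add, Matrix.add_mul, mul_vecMulVec, mul_vecMulVec, vecMulVec_mul,
    vecMulVec_mul]
  simp only [det_fin_three, Matrix.add_apply, vecMulVec_apply]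
  ring

theorem exists_dual_basis {u v : Fin 4 → ℂ} (h : LinearIndependent ℂ ![u, v]) :
    ∃ p n d : Fin 2 → Fin 4 → ℂ,
      (p 0 ⬝ᵥ u = 1 ∧ p 0 ⬝ᵥ v = 0 ∧ p 1 ⬝ᵥ u = 0 ∧ p 1 ⬝ᵥ v = 1) ∧
      (∀ i, n i ⬝ᵥ u = 0 ∧ n i ⬝ᵥ v = 0) ∧ ∀ i k, n i ⬝ᵥ d k = if i = k then 1 else 0 := by
  obtain ⟨x, hx⟩ := exists_linearIndependent_cons_of_lt_finrank h (by simp)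
  obtain ⟨y, hy⟩ := exists_linearIndependent_cons_of_lt_finrank hx (by simp)
  -- New vectors are prepended, so `u` and `v` have indices 2 and 3.
  let b := basisOfLinearIndependentOfCardEqFinrank hy (by simp)
  have hb : ∀ i, b i = ![y, x, u, v] i := by
    intro i
    simp only [b, coe_basisOfLinearIndependentOfCardEqFinrank]
    rfl
  let c : Fin 4 → Fin 4 → ℂ := fun i k => b.coord i (Pi.single k 1)
  have hc : ∀ i z, c i ⬝ᵥ z = b.coord i z := by
    intro i z
    conv_rhs => rw [← Finset.univ_sum_single z]
    rw [map_sum, dotProduct]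
    refine Finset.sum_congr rfl fun k _ => ?_
    have : (Pi.single k (z k) : Fin 4 → ℂ) = z k • Pi.single k 1 := by
      rw [← Pi.single_smul', smul_eq_mul, mul_one]
    rw [this, map_smul, smul_eq_mul, mul_comm]
  have hcb : ∀ i k, c i ⬝ᵥ ![y, x, u, v] k = if k = i then 1 else 0 := by
    intro i k
    rw [hc, ← hb, b.coord_apply, b.repr_self, Finsupp.single_apply]
  refine ⟨![c 2, c 3], ![c 0, c 1], ![y, x], ⟨?_, ?_, ?_, ?_⟩, fun i => ?_, fun i k => ?_⟩
  · exact hcb 2 2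
  · exact hcb 2 3
  · exact hcb 3 2
  · exact hcb 3 3
  · fin_cases i
    · exact ⟨hcb 0 2, hcb 0 3⟩
    · exact ⟨hcb 1 2, hcb 1 3⟩
  · fin_cases i <;> fin_cases k
    · exact hcb 0 0
    · exact hcb 0 1
    · exact hcb 1 0
    · exact hcb 1 1

/-- If `u = cv`, the form is `2c vvᵀ` and `hp` puts `v` on the quadric when `c ≠ 0`, so `M` would be
an isotropic product. -/
theorem linearIndependent_of_not_mem_isotropicCone {M : Matrix (Fin 3) (Fin 3) ℂ}
    (hM : M ∉ isotropicCone) {u v : Fin 4 → ℂ}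
    (huv : spinor Complex.I M = vecMulVec u v + vecMulVec v u)
    (hp : u 0 * v 3 + v 0 * u 3 = u 1 * v 2 + v 1 * u 2) : LinearIndependent ℂ ![u, v] := by
  have key : ∀ (u v : Fin 4 → ℂ) (c : ℂ), spinor Complex.I M = vecMulVec u v + vecMulVec v u →
      u 0 * v 3 + v 0 * u 3 = u 1 * v 2 + v 1 * u 2 → u = c • v → M ∈ isotropicCone := by
    rintro _ v c huv hp rfl
    by_cases hc : c = 0
    · refine mem_isotropicCone_of_spinor_eq (n := 0) (c := 0) (by simp) ?_
      simp [huv, hc]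
    · refine mem_isotropicCone_of_spinor_eq (n := v) (c := 2 * c) ?_ ?_
      · simp only [Pi.smul_apply, smul_eq_mul] at hp
        have : c * (v 0 * v 3 - v 1 * v 2) = 0 := by linear_combination hp / 2
        linear_combination (mul_eq_zero.1 this).resolve_left hc
      · rw [huv, smul_vecMulVec, vecMulVec_smul, ← two_smul ℂ, smul_smul]
  rw [LinearIndependent.pair_iff]
  intro s t hst
  by_contra hne
  rw [not_and_or] at hne
  rcases hne with hs | ht
  · refine hM (key u v (-(t / s)) huv hp ?_)
    ext i
    have := congrFun hst i
    simp at this ⊢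
    field_simp
    linear_combination this
  · refine hM (key v u (-(s / t)) (by rw [huv, add_comm]) (by linear_combination hp) ?_)
    ext i
    have := congrFun hst i
    simp at this ⊢
    field_simp
    linear_combination this

theorem dotProduct_vecMulVec_mulVec {n : Type*} [Fintype n] (x y a b : n → ℂ) :
    x ⬝ᵥ (vecMulVec a b *ᵥ y) = (x ⬝ᵥ a) * (b ⬝ᵥ y) := by
  rw [vecMulVec_mulVec]
  simp [mul_comm]

theorem mul_mul_transpose_apply {m n : Type*} [Fintype n] (A B : Matrix m n ℂ)
    (S : Matrix n n ℂ) (i k : m) : (A * S * Bᵀ) i k = A i ⬝ᵥ (S *ᵥ B k) := by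
  rw [dotProduct_mulVec]
  rfl

/-- The quadratic form of `spinor V` vanishes on the kernel of `spinor M` for
tangent vectors `V` at `M`. -/
theorem dotProduct_spinor_mulVec_eq_zero {p : PMat} {u v : Fin 4 → ℂ}
    (huv : spinor Complex.I p.rep = vecMulVec u v + vecMulVec v u) {p₀ p₁ n n' : Fin 4 → ℂ}
    (h0u : p₀ ⬝ᵥ u = 1) (h0v : p₀ ⬝ᵥ v = 0) (h1u : p₁ ⬝ᵥ u = 0) (h1v : p₁ ⬝ᵥ v = 1)
    (hnu : n ⬝ᵥ u = 0) (hnv : n ⬝ᵥ v = 0) (hnu' : n' ⬝ᵥ u = 0) (hnv' : n' ⬝ᵥ v = 0)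
    {V : Matrix (Fin 3) (Fin 3) ℂ} (hV : V ∈ coneTangentSpace essentialVariety p) :
    n ⬝ᵥ (spinor Complex.I V *ᵥ n') = 0 := by
  rw [mem_coneTangentSpace_iff] at hV
  let A : Matrix (Fin 3) (Fin 4) ℂ := of ![p₀, p₁, n]
  let B : Matrix (Fin 3) (Fin 4) ℂ := of ![p₀, p₁, n']
  have h := hV _ (spinorMinor_mem A B)
  let β : Matrix (Fin 3) (Fin 3) ℂ := A * spinor Complex.I V * Bᵀ
  have hβ : β 2 2 = n ⬝ᵥ (spinor Complex.I V *ᵥ n') := mul_mul_transpose_apply A B _ 2 2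
  have h0 : A * spinor Complex.I p.rep * Bᵀ = !![0, 1, 0; 1, 0, 0; 0, 0, 0] := by
    ext i k
    rw [mul_mul_transpose_apply, huv, add_mulVec, dotProduct_add, dotProduct_vecMulVec_mulVec,
      dotProduct_vecMulVec_mulVec, dotProduct_comm v, dotProduct_comm u]
    have hA : ∀ i, A i = ![p₀, p₁, n] i := fun _ => rfl
    have hB : ∀ i, B i = ![p₀, p₁, n'] i := fun _ => rfl
    rw [hA, hB]
    fin_cases i <;> fin_cases k <;> simp [*]
  -- Since `p.rep` contributes only a hyperbolic block, the determinant along the line has no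
  -- constant term and its linear coefficient in `t` is `-β 2 2`.
  let c₂ : ℂ := β 0 2 * β 2 1 + β 1 2 * β 2 0 - β 2 2 * (β 0 1 + β 1 0)
  have he : (fun t : ℂ => evalAt (p.rep + t • V) (spinorMinor A B)) =
      fun t => t * (-β 2 2) + t ^ 2 * (c₂ + t * β.det) := by
    ext t
    have : A * spinor Complex.I (p.rep + t • V) * Bᵀ =
        !![0, 1, 0; 1, 0, 0; 0, 0, 0] + t • β := by
      rw [spinor_add, spinor_smul, Matrix.mul_add, Matrix.add_mul, h0, Matrix.mul_smul,
        Matrix.smul_mul]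
    rw [evalAt_spinorMinor, this]
    simp [det_fin_three, c₂]
    ring
  rw [he] at h
  have h' : HasDerivAt (fun t : ℂ => t * (-β 2 2) + t ^ 2 * (c₂ + t * β.det)) (-β 2 2) 0 := by
    have h1 := (hasDerivAt_id (0 : ℂ)).mul_const (-β 2 2)
    have h2 := (hasDerivAt_pow 2 (0 : ℂ)).mul
      (((hasDerivAt_id (0 : ℂ)).mul_const β.det).const_add c₂)
    exact (h1.add h2).congr_deriv (by simp)
  rw [← hβ]
  simpa using h'.unique h

theorem exists_polar_eq_one {u : Fin 4 → ℂ} (hu : u ≠ 0) :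
    ∃ z : Fin 4 → ℂ, u 0 * z 3 + z 0 * u 3 - u 1 * z 2 - z 1 * u 2 = 1 := by
  by_cases h0 : u 0 = 0
  · by_cases h1 : u 1 = 0
    · by_cases h2 : u 2 = 0
      · have h3 : u 3 ≠ 0 := by
          intro h3
          apply hu
          ext i
          fin_cases i <;> simpa
        exact ⟨![(u 3)⁻¹, 0, 0, 0], by simp [h3]⟩
      · exact ⟨![0, -(u 2)⁻¹, 0, 0], by simp [h2]⟩
    · exact ⟨![0, 0, -(u 1)⁻¹, 0], by simp [h1]⟩
  · exact ⟨![0, 0, 0, (u 0)⁻¹], by simp [h0]⟩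

/-- `Φ` records the restriction of the form to the kernel spanned by `n 0`, `n 1`. Tangent vectors
lie in the kernel of `Φ`, which has dimension `9 - 3` once `Φ` is surjective. -/
theorem finrank_coneTangentSpace_le {p : PMat} (hp : p ∈ essentialVariety)
    (hp' : p ∉ isotropicProducts) :
    Module.finrank ℂ (coneTangentSpace essentialVariety p) ≤ 6 := by
  rw [mem_isotropicProducts_iff] at hp'
  obtain ⟨u, v, huv, hpol⟩ := exists_spinor_eq_of_mem_essentialCone hp
  obtain ⟨q, n, d, ⟨h0u, h0v, h1u, h1v⟩, hn, hnd⟩ :=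
    exists_dual_basis (linearIndependent_of_not_mem_isotropicCone hp' huv hpol)
  let Φ : Matrix (Fin 3) (Fin 3) ℂ →ₗ[ℂ] Fin 3 → ℂ :=
    { toFun := fun V => ![n 0 ⬝ᵥ (spinor Complex.I V *ᵥ n 0), n 0 ⬝ᵥ (spinor Complex.I V *ᵥ n 1),
        n 1 ⬝ᵥ (spinor Complex.I V *ᵥ n 1)]
      map_add' := fun V W => by
        simp only [spinor_add, add_mulVec, dotProduct_add]
        ext i
        fin_cases i <;> simp
      map_smul' := fun c V => by
        simp only [spinor_smul, smul_mulVec, dotProduct_smul]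
        ext i
        fin_cases i <;> simp }
  have hle : coneTangentSpace essentialVariety p ≤ LinearMap.ker Φ := by
    intro V hV
    have := fun i k => dotProduct_spinor_mulVec_eq_zero huv h0u h0v h1u h1v (hn i).1 (hn i).2
      (hn k).1 (hn k).2 hV
    rw [LinearMap.mem_ker]
    ext i
    fin_cases i <;> simp [Φ, this]
  have hsurj : Function.Surjective Φ := by
    intro y
    have hu : u ≠ 0 := by
      rintro rfl
      simp at h0u
    obtain ⟨z, hz⟩ := exists_polar_eq_one hu
    let W₀ : Matrix (Fin 4) (Fin 4) ℂ := y 0 • vecMulVec (d 0) (d 0) +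
      y 1 • (vecMulVec (d 0) (d 1) + vecMulVec (d 1) (d 0)) + y 2 • vecMulVec (d 1) (d 1)
    -- `W₀` has the prescribed restriction but may violate `W 0 3 = W 1 2`. The correction by `uzᵀ +
    -- zuᵀ` restores it and is invisible on the kernel, because each `n i` annihilates `u`.
    let W := W₀ - (W₀ 0 3 - W₀ 1 2) • (vecMulVec u z + vecMulVec z u)
    have hW : spinor Complex.I (ofSpinor W) = W := by
      apply spinor_ofSpinor
      · intro i k
        simp only [W, W₀, Matrix.sub_apply, Matrix.add_apply, Matrix.smul_apply, vecMulVec_apply,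
          smul_eq_mul]
        ring
      · have h1 : W 0 3 - W 1 2 = (W₀ 0 3 - W₀ 1 2) *
            (1 - (u 0 * z 3 + z 0 * u 3 - u 1 * z 2 - z 1 * u 2)) := by
          simp only [W, Matrix.sub_apply, Matrix.smul_apply, Matrix.add_apply, vecMulVec_apply,
            smul_eq_mul]
          ring
        rw [hz, sub_self, mul_zero] at h1
        exact sub_eq_zero.1 h1
    have hWn : ∀ i k, n i ⬝ᵥ (W *ᵥ n k) = y 0 * ((n i ⬝ᵥ d 0) * (n k ⬝ᵥ d 0)) +
        y 1 * ((n i ⬝ᵥ d 0) * (n k ⬝ᵥ d 1) + (n i ⬝ᵥ d 1) * (n k ⬝ᵥ d 0)) +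
        y 2 * ((n i ⬝ᵥ d 1) * (n k ⬝ᵥ d 1)) := by
      intro i k
      simp only [W, W₀, sub_mulVec, add_mulVec, smul_mulVec, dotProduct_sub, dotProduct_add,
        dotProduct_smul, dotProduct_vecMulVec_mulVec, (hn i).1, dotProduct_comm u, (hn k).1,
        dotProduct_comm (d _) (n k), smul_eq_mul]
      ring
    refine ⟨ofSpinor W, ?_⟩
    simp only [Φ, LinearMap.coe_mk, AddHom.coe_mk, hW, hWn, hnd]
    ext i
    fin_cases i <;> simp
  have h1 := LinearMap.finrank_range_add_finrank_ker Φ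
  rw [LinearMap.range_eq_top.2 hsurj, finrank_top, Module.finrank_matrix] at h1
  simp at h1
  have h2 := Submodule.finrank_mono hle
  omega

theorem singularLocus_essentialVariety : singularLocus essentialVariety = isotropicProducts := by
  ext p
  constructor
  · rintro ⟨hp, hlt⟩
    by_contra hp'
    rw [coneLocalDim_essentialVariety hp] at hlt
    have := finrank_coneTangentSpace_le hp hp'
    have hlt : 6 < Module.finrank ℂ (coneTangentSpace essentialVariety p) := by
      exact_mod_cast hlt
    omega
  · intro hp
    have hp' : p ∈ essentialVariety := isotropicCone_subset_essentialCone
      ((mem_isotropicProducts_iff p).1 hp)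
    refine ⟨hp', ?_⟩
    rw [coneLocalDim_essentialVariety hp', coneTangentSpace_eq_top hp, finrank_top,
      Module.finrank_matrix]
    simp
    norm_cast

end EssentialVariety

theorem proposition2p1 :
    (EssentialVariety.singularLocus EssentialVariety.essentialVariety =
        EssentialVariety.isotropicProducts ∧
      EssentialVariety.IsProjectiveSurface EssentialVariety.isotropicProducts) ∧
    EssentialVariety.secondSecantVariety
        (EssentialVariety.singularLocus EssentialVariety.essentialVariety) =
      EssentialVariety.essentialVariety := by
  rw [EssentialVariety.singularLocus_essentialVariety]
  exact ⟨⟨rfl, EssentialVariety.isProjectiveSurface_isotropicProducts⟩,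
    EssentialVariety.secondSecantVariety_isotropicProducts⟩
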